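/- Let $\Bbbk$ be a field. All Hopf monoids are connected Hopf monoids in vector species over $\Bbbk$ (connected bimonoids: natural, (co)associative, (co)unital products $\mu_{I,J}:\mathbf H[I]\otimes \mathbf H[J]\to \mathbf H[I\sqcup J]$ and coproducts $\Delta_{I,J}:\mathbf H[I\sqcup J]\to \mathbf H[I]\otimes \mathbf H[J]$ that are compatible with each other, with $\mathbf H[\emptyset]=\Bbbk$). For a finite set $I$: * $\mathbf L^*[I]$ is the vector space with basis the linear orders on $I$; $\mu_{I,J}(w\otimes u)=\sum_v v$ over all linear orders $v$ on $I\sqcup J$ with $v|_I=w$ and $v|_J=u$ (shuffles); $\Delta_{I,J}(v)=v|_I\otimes v|_J$ if $I$ is an initial segment of $v$, and $0$ otherwise. * $\mathbf{GP}[I]$ is the vector space with basis the generalized permutahedra in $\mathbb R^I$, i.e. the nonempty polytopes $\mathfrak p\subset\mathbb R^I$ whose normal fan is a coarsening of the braid fan; $\mu_{I,J}(\mathfrak p\otimes\mathfrak q)=\mathfrak p\times\mathfrak q$ and $\Delta_{I,J}(\mathfrak p)=\mathfrak p|I\otimes\mathfrak p/I$, where $\mathfrak p|I\subset\mathbb R^I$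 and $\mathfrak p/I\subset\mathbb R^J$ are the generalized permutahedra such that $\mathfrak p|I\times\mathfrak p/I$ is the face of $\mathfrak p\subset\mathbb R^{I\sqcup J}$ on which the functional $y\mapsto\sum_{i\in I}y_i$ is maximal. * $\mathbf{OGP}=\mathbf L^*\times\mathbf{GP}$ is the Hadamard product: $\mathbf{OGP}[I]=\mathbf L^*[I]\otimes\mathbf{GP}[I]$, with componentwise product and coproduct. Then the symmetrization map $\mathrm{Symm}:\mathbf{GP}\to\mathbf{OGP}$, given for each finite set $I$ by the linear map $\mathbf{GP}[I]\to\mathbf{OGP}[I]$ with $$\mathrm{Symm}(\mathfrak p)=\sum_{w}w\otimes\mathfrak p\qquad\text{(sum over all linear orders $w$ on $I$)}$$ for generalized permutahedra $\mathfrak p\subset\mathbb R^I$, is an injective morphism of Hopf monoids: it is natural in $I$, respects products, units, coproducts and counits, and every component $\mathbf{GP}[I]\to\mathbf{OGP}[I]$ is injective. -/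

import Mathlib

open scoped TensorProduct

universe u v w w'

/-- A vector species over `k`: a functor from finite sets and bijections to `k`-vector spaces. -/
structure VectorSpecies (k : Type v) [Field k] where
  obj : (I : Type u) → [Fintype I] → Type w
  [addCommGroup : ∀ (I : Type u) [Fintype I], AddCommGroup (obj I)]
  [module : ∀ (I : Type u) [Fintype I], Module k (obj I)]
  map : ∀ {I J : Type u} [Fintype I] [Fintype J], (I ≃ J) → (obj I →ₗ[k] obj J)
  map_refl : ∀ (I : Type u) [Fintype I] (x : obj I), map (Equiv.refl I) x = x
  map_trans : ∀ {I J K : Type u} [Fintype I] [Fintype J] [Fintype K] (σ : I ≃ J) (τ : J ≃ K)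
    (x : obj I), map (σ.trans τ) x = map τ (map σ x)

attribute [instance] VectorSpecies.addCommGroup VectorSpecies.module

/-- A connected Hopf monoid in vector species, i.e. a connected bimonoid (the antipode then exists
automatically). Disjoint unions are modelled by `⊕` and the empty set by `PEmpty`. A morphism of
species between the unit species and `H` amounts to a linear map between `k` and `H[∅]`; so the
unit is given by the element `one` (the image of `1 : k`) and the counit by `counit`. -/
structure ConnectedHopfMonoid (k : Type v) [Field k] extends VectorSpecies.{u, v, w} k where
  mul : ∀ (I J : Type u) [Fintype I] [Fintype J], obj I ⊗[k] obj J →ₗ[k] obj (I ⊕ J)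
  one : obj PEmpty
  comul : ∀ (I J : Type u) [Fintype I] [Fintype J], obj (I ⊕ J) →ₗ[k] obj I ⊗[k] obj J
  counit : obj PEmpty →ₗ[k] k
  /-- naturality of the product -/
  mul_natural : ∀ {I J I' J' : Type u} [Fintype I] [Fintype J] [Fintype I'] [Fintype J']
    (σ : I ≃ I') (τ : J ≃ J') (x : obj I) (y : obj J),
    map (Equiv.sumCongr σ τ) (mul I J (x ⊗ₜ y)) = mul I' J' (map σ x ⊗ₜ map τ y)
  /-- naturality of the coproduct -/
  comul_natural : ∀ {I J I' J' : Type u} [Fintype I] [Fintype J] [Fintype I'] [Fintype J']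
    (σ : I ≃ I') (τ : J ≃ J') (x : obj (I ⊕ J)),
    comul I' J' (map (Equiv.sumCongr σ τ) x) = TensorProduct.map (map σ) (map τ) (comul I J x)
  mul_assoc : ∀ (I J K : Type u) [Fintype I] [Fintype J] [Fintype K]
    (x : obj I) (y : obj J) (z : obj K),
    map (Equiv.sumAssoc I J K) (mul (I ⊕ J) K (mul I J (x ⊗ₜ y) ⊗ₜ z)) =
      mul I (J ⊕ K) (x ⊗ₜ mul J K (y ⊗ₜ z))
  one_mul : ∀ (I : Type u) [Fintype I] (x : obj I),
    map (Equiv.emptySum PEmpty I) (mul PEmpty I (one ⊗ₜ x)) = x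
  mul_one : ∀ (I : Type u) [Fintype I] (x : obj I),
    map (Equiv.sumEmpty I PEmpty) (mul I PEmpty (x ⊗ₜ one)) = x
  comul_coassoc : ∀ (I J K : Type u) [Fintype I] [Fintype J] [Fintype K] (x : obj ((I ⊕ J) ⊕ K)),
    TensorProduct.assoc k (obj I) (obj J) (obj K)
        (TensorProduct.map (comul I J) LinearMap.id (comul (I ⊕ J) K x)) =
      TensorProduct.map LinearMap.id (comul J K)
        (comul I (J ⊕ K) (map (Equiv.sumAssoc I J K) x))
  counit_comul : ∀ (I : Type u) [Fintype I] (x : obj (PEmpty ⊕ I)),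
    TensorProduct.lid k (obj I) (TensorProduct.map counit LinearMap.id (comul PEmpty I x)) =
      map (Equiv.emptySum PEmpty I) x
  comul_counit : ∀ (I : Type u) [Fintype I] (x : obj (I ⊕ PEmpty)),
    TensorProduct.rid k (obj I) (TensorProduct.map LinearMap.id counit (comul I PEmpty x)) =
      map (Equiv.sumEmpty I PEmpty) x
  /-- compatibility of product and coproduct, for the decompositions
  `(A ⊔ B) ⊔ (C ⊔ D) = (A ⊔ C) ⊔ (B ⊔ D)` of one set -/
  comul_mul : ∀ (A B C D : Type u) [Fintype A] [Fintype B] [Fintype C] [Fintype D]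
    (x : obj (A ⊕ B)) (y : obj (C ⊕ D)),
    comul (A ⊕ C) (B ⊕ D) (map (Equiv.sumSumSumComm A B C D) (mul (A ⊕ B) (C ⊕ D) (x ⊗ₜ y))) =
      TensorProduct.map (mul A C) (mul B D)
        (TensorProduct.tensorTensorTensorComm k (obj A) (obj B) (obj C) (obj D)
          (comul A B x ⊗ₜ comul C D y))
  comul_one : comul PEmpty PEmpty (map (Equiv.emptySum PEmpty PEmpty).symm one) = one ⊗ₜ one
  counit_mul : ∀ x y : obj PEmpty,
    counit (map (Equiv.emptySum PEmpty PEmpty) (mul PEmpty PEmpty (x ⊗ₜ y))) =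
      counit x * counit y
  counit_one : counit one = 1
  /-- connectedness: the unit identifies `k` with `H[∅]` -/
  connected : ∀ x : obj PEmpty, counit x • one = x

/-- A morphism of Hopf monoids: a natural family of linear maps that respects products, units,
coproducts and counits. -/
structure IsHopfMorphism {k : Type v} [Field k] (H : ConnectedHopfMonoid.{u, v, w} k)
    (K : ConnectedHopfMonoid.{u, v, w'} k)
    (f : ∀ (I : Type u) [Fintype I], H.obj I →ₗ[k] K.obj I) : Prop where
  natural : ∀ {I J : Type u} [Fintype I] [Fintype J] (σ : I ≃ J) (x : H.obj I),
    f J (H.map σ x) = K.map σ (f I x)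
  map_mul : ∀ (I J : Type u) [Fintype I] [Fintype J] (x : H.obj I) (y : H.obj J),
    f (I ⊕ J) (H.mul I J (x ⊗ₜ y)) = K.mul I J (f I x ⊗ₜ f J y)
  map_one : f PEmpty H.one = K.one
  map_comul : ∀ (I J : Type u) [Fintype I] [Fintype J] (x : H.obj (I ⊕ J)),
    K.comul I J (f (I ⊕ J) x) = TensorProduct.map (f I) (f J) (H.comul I J x)
  map_counit : ∀ x : H.obj PEmpty, K.counit (f PEmpty x) = H.counit x

section Hadamard

variable {k : Type v} [Field k]

theorem hadamard_coassoc_left {A B A' B' A₁ A₂ A₁' A₂' : Type*}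
    [AddCommGroup A] [AddCommGroup B] [AddCommGroup A'] [AddCommGroup B']
    [AddCommGroup A₁] [AddCommGroup A₂] [AddCommGroup A₁'] [AddCommGroup A₂']
    [Module k A] [Module k B] [Module k A'] [Module k B']
    [Module k A₁] [Module k A₂] [Module k A₁'] [Module k A₂']
    (d : A →ₗ[k] A₁ ⊗[k] A₂) (d' : A' →ₗ[k] A₁' ⊗[k] A₂') (a : A ⊗[k] B) (b : A' ⊗[k] B') :
    TensorProduct.assoc k (A₁ ⊗[k] A₁') (A₂ ⊗[k] A₂') (B ⊗[k] B')
      (TensorProduct.map ((TensorProduct.tensorTensorTensorComm k A₁ A₂ A₁' A₂').toLinearMap ∘ₗ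
        TensorProduct.map d d') LinearMap.id
        (TensorProduct.tensorTensorTensorComm k A B A' B' (a ⊗ₜ b))) =
      TensorProduct.map LinearMap.id
        (TensorProduct.tensorTensorTensorComm k A₂ B A₂' B').toLinearMap
        (TensorProduct.tensorTensorTensorComm k A₁ (A₂ ⊗[k] B) A₁' (A₂' ⊗[k] B')
          (TensorProduct.assoc k A₁ A₂ B (TensorProduct.map d LinearMap.id a) ⊗ₜ
            TensorProduct.assoc k A₁' A₂' B' (TensorProduct.map d' LinearMap.id b))) := by
  induction a with
  | zero => simp
  | add x y hx hy => simp only [TensorProduct.add_tmul, map_add, hx, hy]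
  | tmul a₀ b₀ =>
    induction b with
    | zero => simp
    | add x y hx hy => simp only [TensorProduct.tmul_add, map_add, hx, hy]
    | tmul a₁ b₁ =>
      simp only [TensorProduct.tensorTensorTensorComm_tmul, TensorProduct.map_tmul,
        LinearMap.comp_apply, LinearMap.id_apply, LinearEquiv.coe_coe]
      generalize d a₀ = s
      generalize d' a₁ = t
      induction s with
      | zero => simp
      | add x y hx hy => simp only [TensorProduct.add_tmul, map_add, hx, hy]
      | tmul _ _ =>
        induction t with
        | zero => simp
        | add x y hx hy => simp only [TensorProduct.add_tmul, TensorProduct.tmul_add, map_add, hx, hy]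
        | tmul _ _ => simp

theorem hadamard_map_tensorComm {A B A' B' C D C' D' : Type*}
    [AddCommGroup A] [AddCommGroup B] [AddCommGroup A'] [AddCommGroup B']
    [AddCommGroup C] [AddCommGroup D] [AddCommGroup C'] [AddCommGroup D']
    [Module k A] [Module k B] [Module k A'] [Module k B']
    [Module k C] [Module k D] [Module k C'] [Module k D']
    (f : A →ₗ[k] C) (g : B →ₗ[k] D) (f' : A' →ₗ[k] C') (g' : B' →ₗ[k] D')
    (a : A ⊗[k] B) (b : A' ⊗[k] B') :
    TensorProduct.map (TensorProduct.map f f') (TensorProduct.map g g')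
        (TensorProduct.tensorTensorTensorComm k A B A' B' (a ⊗ₜ b)) =
      TensorProduct.tensorTensorTensorComm k C D C' D'
        (TensorProduct.map f g a ⊗ₜ TensorProduct.map f' g' b) := by
  induction a with
  | zero => simp
  | add x y hx hy => simp only [TensorProduct.add_tmul, map_add, hx, hy]
  | tmul a₀ b₀ =>
    induction b with
    | zero => simp
    | add x y hx hy => simp only [TensorProduct.tmul_add, map_add, hx, hy]
    | tmul a₁ b₁ => simp

theorem hadamard_lid {A A' U U' : Type*}
    [AddCommGroup A] [AddCommGroup A'] [AddCommGroup U] [AddCommGroup U']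
    [Module k A] [Module k A'] [Module k U] [Module k U']
    (e : U →ₗ[k] k) (e' : U' →ₗ[k] k) (a : U ⊗[k] A) (b : U' ⊗[k] A') :
    TensorProduct.lid k (A ⊗[k] A')
      (TensorProduct.map ((TensorProduct.lid k k).toLinearMap ∘ₗ TensorProduct.map e e')
        LinearMap.id (TensorProduct.tensorTensorTensorComm k U A U' A' (a ⊗ₜ b))) =
      TensorProduct.lid k A (TensorProduct.map e LinearMap.id a) ⊗ₜ
        TensorProduct.lid k A' (TensorProduct.map e' LinearMap.id b) := by
  induction a with
  | zero => simp
  | add x y hx hy => simp only [TensorProduct.add_tmul, map_add, hx, hy]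
  | tmul a₀ b₀ =>
    induction b with
    | zero => simp
    | add x y hx hy => simp only [TensorProduct.tmul_add, map_add, hx, hy]
    | tmul a₁ b₁ => simp [← TensorProduct.smul_tmul', smul_smul, mul_comm]

theorem hadamard_rid {A A' U U' : Type*}
    [AddCommGroup A] [AddCommGroup A'] [AddCommGroup U] [AddCommGroup U']
    [Module k A] [Module k A'] [Module k U] [Module k U']
    (e : U →ₗ[k] k) (e' : U' →ₗ[k] k) (a : A ⊗[k] U) (b : A' ⊗[k] U') :
    TensorProduct.rid k (A ⊗[k] A')
      (TensorProduct.map LinearMap.id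
        ((TensorProduct.lid k k).toLinearMap ∘ₗ TensorProduct.map e e')
        (TensorProduct.tensorTensorTensorComm k A U A' U' (a ⊗ₜ b))) =
      TensorProduct.rid k A (TensorProduct.map LinearMap.id e a) ⊗ₜ
        TensorProduct.rid k A' (TensorProduct.map LinearMap.id e' b) := by
  induction a with
  | zero => simp
  | add x y hx hy => simp only [TensorProduct.add_tmul, map_add, hx, hy]
  | tmul a₀ b₀ =>
    induction b with
    | zero => simp
    | add x y hx hy => simp only [TensorProduct.tmul_add, map_add, hx, hy]
    | tmul a₁ b₁ => simp [← TensorProduct.smul_tmul', smul_smul, mul_comm]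

theorem hadamard_comul_mul {A B C D A' B' C' D' M N M' N' : Type*}
    [AddCommGroup A] [AddCommGroup B] [AddCommGroup C] [AddCommGroup D]
    [AddCommGroup A'] [AddCommGroup B'] [AddCommGroup C'] [AddCommGroup D']
    [AddCommGroup M] [AddCommGroup N] [AddCommGroup M'] [AddCommGroup N']
    [Module k A] [Module k B] [Module k C] [Module k D]
    [Module k A'] [Module k B'] [Module k C'] [Module k D']
    [Module k M] [Module k N] [Module k M'] [Module k N']
    (m : A ⊗[k] C →ₗ[k] M) (n : B ⊗[k] D →ₗ[k] N)
    (m' : A' ⊗[k] C' →ₗ[k] M') (n' : B' ⊗[k] D' →ₗ[k] N')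
    (a : A ⊗[k] B) (c : C ⊗[k] D) (a' : A' ⊗[k] B') (c' : C' ⊗[k] D') :
    TensorProduct.tensorTensorTensorComm k M N M' N'
      (TensorProduct.map m n (TensorProduct.tensorTensorTensorComm k A B C D (a ⊗ₜ c)) ⊗ₜ
        TensorProduct.map m' n' (TensorProduct.tensorTensorTensorComm k A' B' C' D' (a' ⊗ₜ c'))) =
    TensorProduct.map
      (TensorProduct.map m m' ∘ₗ (TensorProduct.tensorTensorTensorComm k A A' C C').toLinearMap)
      (TensorProduct.map n n' ∘ₗ (TensorProduct.tensorTensorTensorComm k B B' D D').toLinearMap)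
      (TensorProduct.tensorTensorTensorComm k (A ⊗[k] A') (B ⊗[k] B') (C ⊗[k] C') (D ⊗[k] D')
        (TensorProduct.tensorTensorTensorComm k A B A' B' (a ⊗ₜ a') ⊗ₜ
          TensorProduct.tensorTensorTensorComm k C D C' D' (c ⊗ₜ c'))) := by
  induction a with
  | zero => simp
  | add x y hx hy => simp only [TensorProduct.add_tmul, TensorProduct.tmul_add, map_add, hx, hy]
  | tmul _ _ =>
  induction c with
  | zero => simp
  | add x y hx hy => simp only [TensorProduct.add_tmul, TensorProduct.tmul_add, map_add, hx, hy]
  | tmul _ _ =>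
  induction a' with
  | zero => simp
  | add x y hx hy => simp only [TensorProduct.add_tmul, TensorProduct.tmul_add, map_add, hx, hy]
  | tmul _ _ =>
  induction c' with
  | zero => simp
  | add x y hx hy => simp only [TensorProduct.add_tmul, TensorProduct.tmul_add, map_add, hx, hy]
  | tmul _ _ => simp

/-- The Hadamard product of two Hopf monoids: `(H × K)[I] = H[I] ⊗ K[I]`, with componentwise
structure. -/
@[reducible] noncomputable def hadamard (H : ConnectedHopfMonoid.{u, v, w} k)
    (K : ConnectedHopfMonoid.{u, v, w'} k) : ConnectedHopfMonoid.{u, v, max w w'} k where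
  obj I _ := H.obj I ⊗[k] K.obj I
  map σ := TensorProduct.map (H.map σ) (K.map σ)
  mul I J _ _ := TensorProduct.map (H.mul I J) (K.mul I J) ∘ₗ
    (TensorProduct.tensorTensorTensorComm k (H.obj I) (K.obj I) (H.obj J) (K.obj J)).toLinearMap
  one := H.one ⊗ₜ K.one
  comul I J _ _ :=
    (TensorProduct.tensorTensorTensorComm k (H.obj I) (H.obj J) (K.obj I) (K.obj J)).toLinearMap ∘ₗ
      TensorProduct.map (H.comul I J) (K.comul I J)
  counit := (TensorProduct.lid k k).toLinearMap ∘ₗ TensorProduct.map H.counit K.counit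
  map_refl I _ x := by
    induction x with
    | zero => simp
    | add x y hx hy => simp only [map_add, hx, hy]
    | tmul a b => simp [H.map_refl, K.map_refl]
  map_trans σ τ x := by
    induction x with
    | zero => simp
    | add x y hx hy => simp only [map_add, hx, hy]
    | tmul a b => simp [H.map_trans, K.map_trans]
  mul_natural σ τ x y := by
    induction x with
    | zero => simp
    | add x y hx hy => simp only [TensorProduct.add_tmul, map_add, hx, hy]
    | tmul a b =>
      induction y with
      | zero => simp
      | add x y hx hy => simp only [TensorProduct.tmul_add, map_add, hx, hy]
      | tmul c d => simp [H.mul_natural, K.mul_natural]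
  comul_natural σ τ x := by
    induction x with
    | zero => simp
    | add x y hx hy => simp only [map_add, hx, hy]
    | tmul a b =>
      simp [H.comul_natural, K.comul_natural, hadamard_map_tensorComm]
  mul_assoc I J K' _ _ _ x y z := by
    induction x with
    | zero => simp
    | add x y hx hy => simp only [TensorProduct.add_tmul, map_add, hx, hy]
    | tmul a b =>
    induction y with
    | zero => simp
    | add x y hx hy => simp only [TensorProduct.add_tmul, TensorProduct.tmul_add, map_add, hx, hy]
    | tmul c d =>
    induction z with
    | zero => simp
    | add x y hx hy => simp only [TensorProduct.tmul_add, map_add, hx, hy]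
    | tmul e f => simp [H.mul_assoc, K.mul_assoc]
  one_mul I _ x := by
    induction x with
    | zero => simp
    | add x y hx hy => simp only [TensorProduct.tmul_add, map_add, hx, hy]
    | tmul a b => simp [H.one_mul, K.one_mul]
  mul_one I _ x := by
    induction x with
    | zero => simp
    | add x y hx hy => simp only [TensorProduct.add_tmul, map_add, hx, hy]
    | tmul a b => simp [H.mul_one, K.mul_one]
  comul_coassoc I J K' _ _ _ x := by
    induction x with
    | zero => simp
    | add x y hx hy => simp only [map_add, hx, hy]
    | tmul a b =>
      simp only [LinearMap.comp_apply, TensorProduct.map_tmul, LinearEquiv.coe_coe]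
      rw [hadamard_coassoc_left, H.comul_coassoc, K.comul_coassoc, ← hadamard_map_tensorComm,
        ← LinearMap.comp_apply, ← TensorProduct.map_comp]
      simp [TensorProduct.map_id]
  counit_comul I _ x := by
    induction x with
    | zero => simp
    | add x y hx hy => simp only [map_add, hx, hy]
    | tmul a b =>
      simp only [LinearMap.comp_apply, TensorProduct.map_tmul, LinearEquiv.coe_coe]
      rw [hadamard_lid, H.counit_comul, K.counit_comul]
  comul_counit I _ x := by
    induction x with
    | zero => simp
    | add x y hx hy => simp only [map_add, hx, hy]
    | tmul a b =>
      simp only [LinearMap.comp_apply, TensorProduct.map_tmul, LinearEquiv.coe_coe]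
      rw [hadamard_rid, H.comul_counit, K.comul_counit]
  comul_mul A B C D _ _ _ _ x y := by
    induction x with
    | zero => simp
    | add x y hx hy => simp only [TensorProduct.add_tmul, map_add, hx, hy]
    | tmul a b =>
      induction y with
      | zero => simp
      | add x y hx hy => simp only [TensorProduct.tmul_add, map_add, hx, hy]
      | tmul c d =>
        simp only [LinearMap.comp_apply, TensorProduct.map_tmul, LinearEquiv.coe_coe,
          TensorProduct.tensorTensorTensorComm_tmul]
        rw [H.comul_mul, K.comul_mul, hadamard_comul_mul]
  comul_one := by simp [H.comul_one, K.comul_one]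
  counit_mul x y := by
    induction x with
    | zero => simp
    | add x y hx hy => simp only [TensorProduct.add_tmul, map_add, hx, hy, add_mul]
    | tmul a b =>
      induction y with
      | zero => simp
      | add x y hx hy => simp only [TensorProduct.tmul_add, map_add, hx, hy, mul_add]
      | tmul c d => simp [H.counit_mul, K.counit_mul, mul_mul_mul_comm]
  counit_one := by simp [H.counit_one, K.counit_one]
  connected x := by
    induction x with
    | zero => simp
    | add x y hx hy => rw [map_add, add_smul, hx, hy]
    | tmul a b =>
      conv_rhs => rw [← H.connected a, ← K.connected b]
      simp [← TensorProduct.smul_tmul', smul_smul, mul_comm]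

end Hadamard

section LinearOrders

/-- The set of linear orders on `I`, given by their relations `≤`. -/
structure LinearOrdering (I : Type u) where
  le : I → I → Prop
  isLinearOrder : IsLinearOrder I le

namespace LinearOrdering

variable {I J K : Type u}

theorem ext_iff_le {v w : LinearOrdering I} : v = w ↔ ∀ i j, v.le i j ↔ w.le i j := by
  obtain ⟨v, _⟩ := v
  obtain ⟨w, _⟩ := w
  simp [funext_iff]

instance [Finite I] : Finite (LinearOrdering I) :=
  Finite.of_injective (fun w : LinearOrdering I => w.le) fun v w h => by
    rw [ext_iff_le]; intro i j; exact iff_of_eq (congrFun (congrFun h i) j)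

noncomputable instance [Fintype I] : Fintype (LinearOrdering I) := Fintype.ofFinite _

/-- The order induced on `I` by an order on `J` along an injection `I → J`. -/
def comap (f : I → J) (hf : Function.Injective f) (w : LinearOrdering J) : LinearOrdering I where
  le i j := w.le (f i) (f j)
  isLinearOrder := by
    have h := w.isLinearOrder
    exact hf.isLinearOrder_onFun (r := w.le)

/-- Relabelling along a bijection. -/
def relabel (σ : I ≃ J) (w : LinearOrdering I) : LinearOrdering J := w.comap σ.symm σ.symm.injective

/-- The restriction of an order on `I ⊔ J` to `I`. -/
def left (w : LinearOrdering (I ⊕ J)) : LinearOrdering I := w.comap Sum.inl Sum.inl_injective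

/-- The restriction of an order on `I ⊔ J` to `J`. -/
def right (w : LinearOrdering (I ⊕ J)) : LinearOrdering J := w.comap Sum.inr Sum.inr_injective

/-- `I` is an initial segment of the order `w` on `I ⊔ J`. -/
def LeftInitial (w : LinearOrdering (I ⊕ J)) : Prop := ∀ (i : I) (j : J), w.le (Sum.inl i) (Sum.inr j)

/-- The unique linear order on the empty set. -/
def empty : LinearOrdering PEmpty.{u + 1} where
  le _ _ := True
  isLinearOrder :=
    { refl := fun a => a.elim, trans := fun a => a.elim, antisymm := fun a => a.elim,
      total := fun a => a.elim }

theorem eq_empty (w : LinearOrdering PEmpty.{u + 1}) : w = empty := by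
  rw [ext_iff_le]; intro i; exact i.elim

/-- Concatenation of linear orders. -/
def concat (w : LinearOrdering I) (u : LinearOrdering J) : LinearOrdering (I ⊕ J) where
  le := Sum.Lex w.le u.le
  isLinearOrder := by
    have hw := w.isLinearOrder
    have hu := u.isLinearOrder
    exact
      { refl := by
          rintro (a | a)
          · exact Sum.Lex.inl (refl a)
          · exact Sum.Lex.inr (refl a)
        trans := by
          rintro (a | a) (b | b) (c | c) <;> simp only [Sum.lex_inl_inl, Sum.lex_inr_inr,
            Sum.lex_inr_inl, Sum.Lex.sep, imp_true_iff, false_imp_iff]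
          · exact fun h h' => _root_.trans h h'
          · exact fun h h' => _root_.trans h h'
        antisymm := by
          rintro (a | a) (b | b) <;> simp only [Sum.lex_inl_inl, Sum.lex_inr_inr,
            Sum.lex_inr_inl, Sum.Lex.sep, imp_true_iff, false_imp_iff]
          · exact fun h h' => congrArg _ (antisymm h h')
          · exact fun h h' => congrArg _ (antisymm h h')
        total := by
          rintro (a | a) (b | b) <;> simp only [Sum.lex_inl_inl, Sum.lex_inr_inr,
            Sum.lex_inr_inl, Sum.Lex.sep, true_or, or_true]
          · exact total_of _ a b
          · exact total_of _ a b }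

theorem concat_eq_iff (w : LinearOrdering I) (u : LinearOrdering J) (v : LinearOrdering (I ⊕ J)) :
    v = concat w u ↔ v.LeftInitial ∧ v.left = w ∧ v.right = u := by
  have hv := v.isLinearOrder
  constructor
  · rintro rfl
    refine ⟨fun i j => Sum.Lex.sep i j, ?_, ?_⟩ <;> rw [ext_iff_le] <;> intro i j <;>
      simp [left, right, comap, concat]
  · rintro ⟨h, rfl, rfl⟩
    rw [ext_iff_le]
    rintro (i | i) (j | j) <;> simp only [concat, left, right, comap, Sum.lex_inl_inl,
      Sum.lex_inr_inr, Sum.lex_inr_inl, Sum.Lex.sep, iff_true, iff_false]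
    · exact h i j
    · intro h'
      exact Sum.inl_ne_inr (antisymm (h j i) h')

end LinearOrdering

variable (k : Type v) [Field k]

/-- The vector space spanned by the linear orders on `I`. -/
abbrev LinOrdSpace (I : Type u) : Type (max u v) := LinearOrdering I →₀ k

namespace LinOrdSpace

open LinearOrdering Classical

variable {I J K I' J' : Type u} [Fintype I] [Fintype J] [Fintype K] [Fintype I'] [Fintype J']

/-- Relabelling, extended linearly. -/
noncomputable def map (σ : I ≃ J) : LinOrdSpace k I →ₗ[k] LinOrdSpace k J :=
  Finsupp.lmapDomain k k (LinearOrdering.relabel σ)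

/-- The shuffle product: `w ⊗ u` is sent to the sum of all orders on `I ⊔ J` that restrict to `w`
on `I` and to `u` on `J`. -/
noncomputable def mul (I J : Type u) [Fintype I] [Fintype J] :
    LinOrdSpace k I ⊗[k] LinOrdSpace k J →ₗ[k] LinOrdSpace k (I ⊕ J) :=
  TensorProduct.lift (Finsupp.lift _ k _ fun w : LinearOrdering I => Finsupp.lift _ k _ fun u : LinearOrdering J =>
    ∑ v : LinearOrdering (I ⊕ J) with v.left = w ∧ v.right = u, Finsupp.single v 1)

/-- The coproduct: `v` is sent to `v|I ⊗ v|J` if `I` is an initial segment of `v`, and to `0`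
otherwise. -/
noncomputable def comul (I J : Type u) [Fintype I] [Fintype J] :
    LinOrdSpace k (I ⊕ J) →ₗ[k] LinOrdSpace k I ⊗[k] LinOrdSpace k J :=
  Finsupp.lift _ k _ fun v : LinearOrdering (I ⊕ J) =>
    if v.LeftInitial then Finsupp.single v.left 1 ⊗ₜ[k] Finsupp.single v.right 1 else 0

/-- The counit, with value `1` on the empty order. -/
noncomputable def counit : LinOrdSpace k PEmpty.{u + 1} →ₗ[k] k :=
  Finsupp.lift _ k _ fun _ => 1

theorem map_single (σ : I ≃ J) (w : LinearOrdering I) (r : k) :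
    map k σ (Finsupp.single w r) = Finsupp.single (w.relabel σ) r := by
  simp [map]

theorem relabel_bijective (σ : I ≃ J) : Function.Bijective (LinearOrdering.relabel σ) := by
  refine Function.bijective_iff_has_inverse.2 ⟨LinearOrdering.relabel σ.symm, fun w => ?_, fun w => ?_⟩ <;>
  · rw [LinearOrdering.ext_iff_le]; intro i j; simp [LinearOrdering.relabel, LinearOrdering.comap]

theorem map_apply (σ : I ≃ J) (f : LinOrdSpace k I) (w : LinearOrdering J) :
    map k σ f w = f (w.relabel σ.symm) := by
  have h : w = (w.relabel σ.symm).relabel σ := by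
    rw [LinearOrdering.ext_iff_le]; intro i j; simp [LinearOrdering.relabel, LinearOrdering.comap]
  conv_lhs => rw [h]
  exact Finsupp.mapDomain_apply (relabel_bijective σ).1 _ _

theorem mul_apply (f : LinOrdSpace k I) (g : LinOrdSpace k J) (v : LinearOrdering (I ⊕ J)) :
    mul k I J (f ⊗ₜ g) v = f v.left * g v.right := by
  induction f using Finsupp.induction_linear with
  | zero => simp
  | add f f' h h' => simp only [TensorProduct.add_tmul, map_add, Finsupp.add_apply, h, h', add_mul]
  | single w r =>
    induction g using Finsupp.induction_linear with
    | zero => simp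
    | add f f' h h' =>
      simp only [TensorProduct.tmul_add, map_add, Finsupp.add_apply, h, h', mul_add]
    | single u s =>
      simp only [mul, TensorProduct.lift.tmul, Finsupp.lift_apply, Finsupp.sum_single_index,
        zero_smul, LinearMap.smul_apply, Finsupp.smul_apply, Finsupp.finsetSum_apply,
        Finsupp.single_apply, Finset.sum_ite_eq', Finset.mem_filter, Finset.mem_univ, true_and,
        eq_comm (a := w), eq_comm (a := u), smul_eq_mul]
      split_ifs <;> simp_all

theorem comul_single (v : LinearOrdering (I ⊕ J)) (r : k) :
    comul k I J (Finsupp.single v r) =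
      if v.LeftInitial then r • (Finsupp.single v.left 1 ⊗ₜ[k] Finsupp.single v.right 1) else 0 := by
  simp only [comul, Finsupp.lift_apply, zero_smul, Finsupp.sum_single_index]
  split_ifs <;> simp

/-- The coefficient of `w ⊗ u` in the coproduct of `f`. -/
theorem comul_coeff (f : LinOrdSpace k (I ⊕ J)) (w : LinearOrdering I) (u : LinearOrdering J) :
    finsuppTensorFinsupp' k (LinearOrdering I) (LinearOrdering J) (comul k I J f) (w, u) = f (w.concat u) := by
  induction f using Finsupp.induction_linear with
  | zero => simp
  | add f f' h h' => simp only [map_add, Finsupp.add_apply, h, h']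
  | single v r =>
    rw [comul_single, Finsupp.single_apply, LinearOrdering.concat_eq_iff]
    by_cases h : v.LeftInitial <;>
      simp [h, Finsupp.single_apply, finsuppTensorFinsupp'_single_tmul_single]

theorem mul_mul_coeff {A B C D : Type u} [Fintype A] [Fintype B] [Fintype C] [Fintype D]
    (a : LinOrdSpace k A ⊗[k] LinOrdSpace k B) (b : LinOrdSpace k C ⊗[k] LinOrdSpace k D)
    (v : LinearOrdering (A ⊕ C)) (v' : LinearOrdering (B ⊕ D)) :
    finsuppTensorFinsupp' k _ _ (TensorProduct.map (mul k A C) (mul k B D)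
      (TensorProduct.tensorTensorTensorComm k _ _ _ _ (a ⊗ₜ b))) (v, v') =
    finsuppTensorFinsupp' k _ _ a (v.left, v'.left) *
      finsuppTensorFinsupp' k _ _ b (v.right, v'.right) := by
  induction a with
  | zero => simp
  | add x y hx hy => simp only [TensorProduct.add_tmul, map_add, Finsupp.add_apply, hx, hy, add_mul]
  | tmul a₀ b₀ =>
    induction b with
    | zero => simp
    | add x y hx hy =>
      simp only [TensorProduct.tmul_add, map_add, Finsupp.add_apply, hx, hy, mul_add]
    | tmul a₁ b₁ => simp [mul_apply, finsuppTensorFinsupp'_apply_apply, mul_mul_mul_comm]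

end LinOrdSpace

open LinearOrdering LinOrdSpace Classical in
/-- The Hopf monoid `L*` of linear orders. -/
@[reducible] noncomputable def LStar : ConnectedHopfMonoid.{u, v, max u v} k where
  obj I _ := LinOrdSpace k I
  map σ := LinOrdSpace.map k σ
  mul I J _ _ := LinOrdSpace.mul k I J
  one := Finsupp.single LinearOrdering.empty 1
  comul I J _ _ := LinOrdSpace.comul k I J
  counit := LinOrdSpace.counit k
  map_refl I _ x := by
    ext w; rw [LinOrdSpace.map_apply]; rfl
  map_trans σ τ x := by
    ext w; simp only [LinOrdSpace.map_apply]; rfl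
  mul_natural σ τ x y := by
    ext w; simp only [LinOrdSpace.map_apply, LinOrdSpace.mul_apply]; rfl
  comul_natural σ τ x := by
    induction x using Finsupp.induction_linear with
    | zero => simp
    | add x y hx hy => simp only [map_add, hx, hy]
    | single w r =>
      have h : (w.relabel (Equiv.sumCongr σ τ)).LeftInitial ↔ w.LeftInitial := by
        simp [LeftInitial, relabel, comap, σ.symm.surjective.forall, τ.symm.surjective.forall]
      rw [LinOrdSpace.map_single, comul_single, comul_single]
      by_cases h' : w.LeftInitial
      · rw [if_pos h', if_pos (h.2 h')]
        simp only [_root_.map_smul, TensorProduct.map_tmul, LinOrdSpace.map_single]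
        rfl
      · rw [if_neg h', if_neg (mt h.1 h'), map_zero]
  mul_assoc I J K _ _ _ x y z := by
    ext w; simp only [LinOrdSpace.map_apply, LinOrdSpace.mul_apply, _root_.mul_assoc]; rfl
  one_mul I _ x := by
    ext w; simp only [LinOrdSpace.map_apply, LinOrdSpace.mul_apply]
    rw [eq_empty (left _), Finsupp.single_eq_same, _root_.one_mul]; rfl
  mul_one I _ x := by
    ext w; simp only [LinOrdSpace.map_apply, LinOrdSpace.mul_apply]
    rw [eq_empty (right _), Finsupp.single_eq_same, _root_.mul_one]; rfl
  comul_coassoc I J K _ _ _ x := by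
    induction x using Finsupp.induction_linear with
    | zero => simp
    | add x y hx hy => simp only [map_add, hx, hy]
    | single w r =>
      have hw := w.isLinearOrder
      rw [LinOrdSpace.map_single, comul_single, comul_single]
      have h : (w.LeftInitial ∧ w.left.LeftInitial) ↔
          ((w.relabel (Equiv.sumAssoc I J K)).LeftInitial ∧
            (w.relabel (Equiv.sumAssoc I J K)).right.LeftInitial) := by
        simp only [LeftInitial, relabel, comap, left, right, Sum.forall, Equiv.sumAssoc_symm_apply_inl,
          Equiv.sumAssoc_symm_apply_inr_inl, Equiv.sumAssoc_symm_apply_inr_inr]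
        grind
      by_cases h₁ : w.LeftInitial ∧ w.left.LeftInitial
      · rw [if_pos h₁.1, if_pos (h.1 h₁).1]
        simp only [_root_.map_smul, TensorProduct.map_tmul, comul_single, if_pos h₁.2,
          if_pos (h.1 h₁).2, one_smul, LinearMap.id_apply, TensorProduct.assoc_tmul]
        rfl
      · have h₂ := mt h.2 h₁
        have e₁ : TensorProduct.map (LinOrdSpace.comul k I J) LinearMap.id
            (if w.LeftInitial then r • (Finsupp.single w.left 1 ⊗ₜ[k] Finsupp.single w.right 1)
              else (0 : LinOrdSpace k (I ⊕ J) ⊗[k] LinOrdSpace k K)) = 0 := by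
          by_cases h₃ : w.LeftInitial
          · simp [if_pos h₃, comul_single, show ¬ w.left.LeftInitial from fun h => h₁ ⟨h₃, h⟩]
          · simp [h₃]
        have e₂ (w' : LinearOrdering (I ⊕ (J ⊕ K))) (h : ¬ (w'.LeftInitial ∧ w'.right.LeftInitial)) :
            TensorProduct.map LinearMap.id (LinOrdSpace.comul k J K)
            (if w'.LeftInitial then r • (Finsupp.single w'.left 1 ⊗ₜ[k] Finsupp.single w'.right 1)
              else (0 : LinOrdSpace k I ⊗[k] LinOrdSpace k (J ⊕ K))) = 0 := by
          by_cases h₃ : w'.LeftInitial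
          · simp [if_pos h₃, comul_single, show ¬ w'.right.LeftInitial from fun h' => h ⟨h₃, h'⟩]
          · simp [h₃]
        rw [e₁, e₂ _ h₂, map_zero]
  counit_comul I _ x := by
    induction x using Finsupp.induction_linear with
    | zero => simp
    | add x y hx hy => simp only [map_add, hx, hy]
    | single w r =>
      have h : w.LeftInitial := fun i => i.elim
      rw [comul_single, if_pos h, LinOrdSpace.map_single]
      simp only [_root_.map_smul, TensorProduct.map_tmul, LinOrdSpace.counit, Finsupp.lift_apply,
        Finsupp.sum_single_index, zero_smul, TensorProduct.lid_tmul, LinearMap.id_apply,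
        Finsupp.smul_single, smul_eq_mul, _root_.mul_one]
      rfl
  comul_counit I _ x := by
    induction x using Finsupp.induction_linear with
    | zero => simp
    | add x y hx hy => simp only [map_add, hx, hy]
    | single w r =>
      have h : w.LeftInitial := fun _ i => i.elim
      rw [comul_single, if_pos h, LinOrdSpace.map_single]
      simp only [_root_.map_smul, TensorProduct.map_tmul, LinOrdSpace.counit, Finsupp.lift_apply,
        Finsupp.sum_single_index, zero_smul, TensorProduct.rid_tmul, LinearMap.id_apply,
        Finsupp.smul_single, smul_eq_mul, _root_.mul_one]
      rfl
  comul_mul A B C D _ _ _ _ x y := by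
    apply (finsuppTensorFinsupp' k _ _).injective
    ext ⟨v, v'⟩
    rw [mul_mul_coeff, comul_coeff, LinOrdSpace.map_apply, LinOrdSpace.mul_apply, comul_coeff,
      comul_coeff]
    congr 2 <;> rw [ext_iff_le] <;> rintro (i | i) (j | j) <;>
      simp [left, right, relabel, comap, concat]
  comul_one := by
    have h (w : LinearOrdering (PEmpty.{u + 1} ⊕ PEmpty.{u + 1})) : w.LeftInitial :=
      fun i => i.elim
    rw [LinOrdSpace.map_single, comul_single, if_pos (h _), one_smul,
      eq_empty (left _), eq_empty (right _)]
  counit_mul x y := by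
    have h (f : LinOrdSpace k PEmpty.{u + 1}) : LinOrdSpace.counit k f = f LinearOrdering.empty := by
      induction f using Finsupp.induction_linear with
      | zero => simp
      | add x y hx hy => simp only [map_add, hx, hy, Finsupp.add_apply]
      | single w r => simp [LinOrdSpace.counit, eq_empty w]
    simp only [h, LinOrdSpace.map_apply, LinOrdSpace.mul_apply, eq_empty (left _),
      eq_empty (right _)]
  counit_one := by simp [LinOrdSpace.counit]
  connected x := by
    induction x using Finsupp.induction_linear with
    | zero => simp
    | add x y hx hy => rw [map_add, add_smul, hx, hy]
    | single w r => simp [LinOrdSpace.counit, eq_empty w]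

end LinearOrders

section GeneralizedPermutahedra

/-- The face `p_x` of `p` on which the functional `y ↦ x ⬝ y` is maximized. -/
def maxFace {I : Type u} [Fintype I] (p : Set (I → ℝ)) (x : I → ℝ) : Set (I → ℝ) :=
  {y | y ∈ p ∧ ∀ z ∈ p, x ⬝ᵥ z ≤ x ⬝ᵥ y}

/-- The (relatively open) normal cone of a face `q` of `p`. -/
def normalCone {I : Type u} [Fintype I] (p q : Set (I → ℝ)) : Set (I → ℝ) :=
  {x | maxFace p x = q}

/-- The normal fan of `p`: the set of normal cones of its faces. -/
def normalFan {I : Type u} [Fintype I] (p : Set (I → ℝ)) : Set (Set (I → ℝ)) :=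
  Set.range fun x => normalCone p (maxFace p x)

/-- The (relatively open) face of the braid arrangement that contains `x`. -/
def braidFace {I : Type u} (x : I → ℝ) : Set (I → ℝ) :=
  {y | ∀ i j, y i < y j ↔ x i < x j}

/-- The braid fan in `ℝ^I`. -/
def braidFan (I : Type u) : Set (Set (I → ℝ)) := Set.range braidFace

/-- `p` is a (nonempty) polytope: the convex hull of a nonempty finite set. -/
def IsPolytope {I : Type u} (p : Set (I → ℝ)) : Prop :=
  ∃ V : Set (I → ℝ), V.Finite ∧ V.Nonempty ∧ p = convexHull ℝ V

/-- A generalized permutahedron in `ℝ^I`: a polytope whose normal fan coarsens the braid fan. -/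
structure GenPerm (I : Type u) [Fintype I] where
  carrier : Set (I → ℝ)
  isPolytope : IsPolytope carrier
  coarsens : ∀ σ ∈ braidFan I, ∃ τ ∈ normalFan carrier, σ ⊆ τ

variable {I J K : Type u} [Fintype I] [Fintype J] [Fintype K]

/-- The product of `A ⊆ ℝ^I` and `B ⊆ ℝ^J`, as a subset of `ℝ^(I ⊔ J)`. -/
def prodSet {I J : Type u} (A : Set (I → ℝ)) (B : Set (J → ℝ)) : Set (I ⊕ J → ℝ) :=
  {z | z ∘ Sum.inl ∈ A ∧ z ∘ Sum.inr ∈ B}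

/-- The image of `A ⊆ ℝ^I` under the isomorphism `ℝ^I ≃ ℝ^J` that relabels coordinates by `σ`. -/
def relabelSet {I J : Type u} (σ : I ≃ J) (A : Set (I → ℝ)) : Set (J → ℝ) := {z | z ∘ σ ∈ A}

/-- The projection of a subset of `ℝ^(I ⊔ J)` to `ℝ^I`. -/
def projLeft {I J : Type u} (A : Set (I ⊕ J → ℝ)) : Set (I → ℝ) := (fun z => z ∘ Sum.inl) '' A

/-- The projection of a subset of `ℝ^(I ⊔ J)` to `ℝ^J`. -/
def projRight {I J : Type u} (A : Set (I ⊕ J → ℝ)) : Set (J → ℝ) := (fun z => z ∘ Sum.inr) '' A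

theorem comp_symm_mem_relabelSet {I J : Type u} (σ : I ≃ J) {A : Set (I → ℝ)} {y : I → ℝ}
    (hy : y ∈ A) : y ∘ σ.symm ∈ relabelSet σ A := by
  simpa [relabelSet, Function.comp_assoc] using hy

theorem dot_sum (x z : I ⊕ J → ℝ) :
    x ⬝ᵥ z = (x ∘ Sum.inl) ⬝ᵥ (z ∘ Sum.inl) + (x ∘ Sum.inr) ⬝ᵥ (z ∘ Sum.inr) := by
  simp [dotProduct, Fintype.sum_sum_type]

theorem dot_relabel (σ : I ≃ J) (x z : J → ℝ) : (x ∘ σ) ⬝ᵥ (z ∘ σ) = x ⬝ᵥ z := by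
  simp [dotProduct, Equiv.sum_comp σ fun j => x j * z j]

theorem maxFace_zero (p : Set (I → ℝ)) : maxFace p 0 = p := by
  ext y; simp [maxFace]

theorem maxFace_relabel (σ : I ≃ J) (p : Set (I → ℝ)) (x : J → ℝ) :
    maxFace (relabelSet σ p) x = relabelSet σ (maxFace p (x ∘ σ)) := by
  ext y
  simp only [maxFace, relabelSet, Set.mem_ofPred_eq, and_congr_right_iff]
  intro _
  constructor
  · intro h z hz
    have := h (z ∘ σ.symm) (by simpa [Function.comp_assoc] using hz)
    rw [dot_relabel, ← dot_relabel σ] at *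
    simpa [Function.comp_assoc, dot_relabel] using this
  · intro h z hz
    simpa [dot_relabel] using h _ hz

theorem maxFace_prod (A : Set (I → ℝ)) (B : Set (J → ℝ)) (x : I ⊕ J → ℝ) :
    maxFace (prodSet A B) x =
      prodSet (maxFace A (x ∘ Sum.inl)) (maxFace B (x ∘ Sum.inr)) := by
  ext y
  simp only [maxFace, prodSet, Set.mem_ofPred_eq, dot_sum]
  constructor
  · rintro ⟨⟨h₁, h₂⟩, h⟩
    refine ⟨⟨h₁, fun a ha => ?_⟩, ⟨h₂, fun b hb => ?_⟩⟩
    · have := h (Sum.elim a (y ∘ Sum.inr)) (by simpa using ⟨ha, h₂⟩)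
      simpa using this
    · have := h (Sum.elim (y ∘ Sum.inl) b) (by simpa using ⟨h₁, hb⟩)
      simpa using this
  · rintro ⟨⟨h₁, h₂⟩, h₃, h₄⟩
    exact ⟨⟨h₁, h₃⟩, fun z hz => add_le_add (h₂ _ hz.1) (h₄ _ hz.2)⟩

theorem maxFace_projLeft (A : Set (I ⊕ J → ℝ)) (x : I → ℝ) :
    maxFace (projLeft A) x = projLeft (maxFace A (Sum.elim x 0)) := by
  ext y
  simp only [maxFace, projLeft, Set.mem_ofPred_eq, Set.mem_image, dot_sum]
  simp
  constructor
  · rintro ⟨⟨z, hz, rfl⟩, h⟩; exact ⟨z, ⟨hz, h⟩, rfl⟩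
  · rintro ⟨z, ⟨hz, h⟩, rfl⟩; exact ⟨⟨z, hz, rfl⟩, h⟩

theorem maxFace_projRight (A : Set (I ⊕ J → ℝ)) (y : J → ℝ) :
    maxFace (projRight A) y = projRight (maxFace A (Sum.elim 0 y)) := by
  ext y
  simp only [maxFace, projRight, Set.mem_ofPred_eq, Set.mem_image, dot_sum]
  simp
  constructor
  · rintro ⟨⟨z, hz, rfl⟩, h⟩; exact ⟨z, ⟨hz, h⟩, rfl⟩
  · rintro ⟨z, ⟨hz, h⟩, rfl⟩; exact ⟨⟨z, hz, rfl⟩, h⟩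

theorem projLeft_prodSet {I J : Type u} {A : Set (I → ℝ)} {B : Set (J → ℝ)} (hB : B.Nonempty) :
    projLeft (prodSet A B) = A := by
  obtain ⟨b, hb⟩ := hB
  ext a
  constructor
  · rintro ⟨z, hz, rfl⟩; exact hz.1
  · intro ha; exact ⟨Sum.elim a b, ⟨by simpa using ha, by simpa using hb⟩, by simp⟩

theorem projRight_prodSet {I J : Type u} {A : Set (I → ℝ)} {B : Set (J → ℝ)} (hA : A.Nonempty) :
    projRight (prodSet A B) = B := by
  obtain ⟨a, ha⟩ := hA
  ext b
  constructor
  · rintro ⟨z, hz, rfl⟩; exact hz.2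
  · intro hb; exact ⟨Sum.elim a b, ⟨by simpa using ha, by simpa using hb⟩, by simp⟩

section Polytope

theorem IsPolytope.isCompact {p : Set (I → ℝ)} (h : IsPolytope p) : IsCompact p := by
  obtain ⟨V, hV, -, rfl⟩ := h
  exact hV.isCompact_convexHull ℝ

theorem IsPolytope.convex {I : Type u} {p : Set (I → ℝ)} (h : IsPolytope p) : Convex ℝ p := by
  obtain ⟨V, -, -, rfl⟩ := h
  exact convex_convexHull ℝ V

theorem IsPolytope.nonempty {I : Type u} {p : Set (I → ℝ)} (h : IsPolytope p) : p.Nonempty := by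
  obtain ⟨V, -, hV, rfl⟩ := h
  exact hV.mono (subset_convexHull ℝ V)

theorem IsPolytope.image {I J : Type u} {p : Set (I → ℝ)} (h : IsPolytope p)
    (f : (I → ℝ) →ₗ[ℝ] (J → ℝ)) : IsPolytope (f '' p) := by
  obtain ⟨V, hV, hV', rfl⟩ := h
  exact ⟨f '' V, hV.image f, hV'.image f, f.image_convexHull V⟩

theorem IsPolytope.relabel {I J : Type u} {p : Set (I → ℝ)} (h : IsPolytope p) (σ : I ≃ J) :
    IsPolytope (relabelSet σ p) := by
  convert h.image (LinearMap.funLeft ℝ ℝ σ.symm) using 1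
  ext z
  constructor
  · intro hz
    exact ⟨_, hz, by ext; simp [LinearMap.funLeft]⟩
  · rintro ⟨y, hy, rfl⟩
    simpa [relabelSet, LinearMap.funLeft, Function.comp_assoc] using hy

theorem IsPolytope.prod {I J : Type u} {p : Set (I → ℝ)} {q : Set (J → ℝ)} (hp : IsPolytope p)
    (hq : IsPolytope q) : IsPolytope (prodSet p q) := by
  obtain ⟨V, hV, hV', rfl⟩ := hp
  obtain ⟨W, hW, hW', rfl⟩ := hq
  refine ⟨(LinearEquiv.sumArrowLequivProdArrow I J ℝ ℝ).symm.toLinearMap '' (V ×ˢ W),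
    (hV.prod hW).image _, (hV'.prod hW').image _, ?_⟩
  rw [← LinearMap.image_convexHull, convexHull_prod]
  ext z
  constructor
  · intro hz
    exact ⟨(z ∘ Sum.inl, z ∘ Sum.inr), hz, by ext (i | i) <;> rfl⟩
  · rintro ⟨⟨a, b⟩, hab, rfl⟩
    exact hab

theorem maxFace_isExposed (p : Set (I → ℝ)) (x : I → ℝ) : IsExposed ℝ p (maxFace p x) := by
  intro _
  refine ⟨LinearMap.toContinuousLinearMap (dotProductBilin ℝ ℝ x), ?_⟩
  rfl

theorem IsPolytope.maxFace_nonempty {p : Set (I → ℝ)} (h : IsPolytope p) (x : I → ℝ) :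
    (maxFace p x).Nonempty := by
  have hc : Continuous fun y : I → ℝ => x ⬝ᵥ y := by unfold dotProduct; fun_prop
  obtain ⟨y, hy, hm⟩ := h.isCompact.exists_isMaxOn h.nonempty hc.continuousOn
  exact ⟨y, hy, fun z hz => hm hz⟩

theorem IsPolytope.maxFace {p : Set (I → ℝ)} (h : IsPolytope p) (x : I → ℝ) :
    IsPolytope (maxFace p x) := by
  have he := maxFace_isExposed p x
  have hn := h.maxFace_nonempty x
  have hc := he.isCompact h.isCompact
  have hx := he.convex h.convex
  obtain ⟨V, hV, hV', rfl⟩ := h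
  have hsub : (_root_.maxFace (convexHull ℝ V) x).extremePoints ℝ ⊆ V :=
    (he.isExtreme.extremePoints_subset_extremePoints).trans extremePoints_convexHull_subset
  have hfin := hV.subset hsub
  refine ⟨_, hfin, hc.extremePoints_nonempty hn, ?_⟩
  rw [← (hfin.isClosed_convexHull ℝ).closure_eq]
  exact (closure_convexHull_extremePoints hc hx).symm

/-- A point on which no functional exceeds its maximum on the compact convex set `q` lies in `q`. -/
theorem IsPolytope.mem_of_forall {q : Set (I → ℝ)} (h : IsPolytope q) (z : I → ℝ)
    (hz : ∀ x : I → ℝ, ∃ y ∈ q, x ⬝ᵥ z ≤ x ⬝ᵥ y) : z ∈ q := by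
  classical
  by_contra hzq
  obtain ⟨f, s, hf, hs⟩ := geometric_hahn_banach_closed_point h.convex h.isCompact.isClosed hzq
  have hdot (y : I → ℝ) : f y = (fun i => f (fun j => if i = j then 1 else 0)) ⬝ᵥ y := by
    have := LinearMap.pi_apply_eq_sum_univ f.toLinearMap y
    simp only [ContinuousLinearMap.coe_coe, smul_eq_mul] at this
    rw [this, dotProduct]
    refine Finset.sum_congr rfl fun i _ => ?_
    rw [mul_comm]
  obtain ⟨y, hy, hle⟩ := hz (fun i => f (fun j => if i = j then 1 else 0))
  rw [← hdot, ← hdot] at hle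
  exact absurd (hf y hy) (by linarith)

end Polytope

theorem coarsens_iff (p : Set (I → ℝ)) :
    (∀ σ ∈ braidFan I, ∃ τ ∈ normalFan p, σ ⊆ τ) ↔
      ∀ x y : I → ℝ, (∀ i j, y i < y j ↔ x i < x j) → maxFace p y = maxFace p x := by
  constructor
  · intro h x y hxy
    obtain ⟨_, ⟨u, rfl⟩, hu⟩ := h _ ⟨x, rfl⟩
    have h₁ : maxFace p y = maxFace p u := hu hxy
    have h₂ : maxFace p x = maxFace p u := hu fun _ _ => Iff.rfl
    rw [h₁, h₂]
  · rintro h _ ⟨x, rfl⟩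
    exact ⟨_, ⟨x, rfl⟩, fun y hy => h x y hy⟩

/-- If the faces in the directions `u + ε v` agree for all small `ε > 0`, they agree with the
`v`-maximal face of the `u`-maximal face. -/
theorem maxFace_maxFace (p F : Set (I → ℝ)) (u v : I → ℝ) (ε₀ : ℝ) (hε₀ : 0 < ε₀)
    (hF : F.Nonempty) (h : ∀ ε, 0 < ε → ε < ε₀ → maxFace p (u + ε • v) = F) :
    maxFace (maxFace p u) v = F := by
  have key : F ⊆ maxFace (maxFace p u) v := by
    intro z hz
    have hzp : z ∈ p := by
      rw [← h (ε₀ / 2) (by linarith) (by linarith)] at hz; exact hz.1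
    have hle : ∀ w ∈ p, ∀ ε, 0 < ε → ε < ε₀ →
        u ⬝ᵥ w + ε * (v ⬝ᵥ w) ≤ u ⬝ᵥ z + ε * (v ⬝ᵥ z) := by
      intro w hw ε h₁ h₂
      have hz' := hz
      rw [← h ε h₁ h₂] at hz'
      simpa [add_dotProduct, smul_dotProduct] using hz'.2 w hw
    have hu : ∀ w ∈ p, u ⬝ᵥ w ≤ u ⬝ᵥ z := by
      intro w hw
      by_contra! hlt
      set D := v ⬝ᵥ z - v ⬝ᵥ w with hD
      set E := u ⬝ᵥ w - u ⬝ᵥ z with hE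
      have hEpos : 0 < E := by linarith
      have h1 : 0 < min (ε₀ / 2) (E / (2 * (|D| + 1))) := by positivity
      have h2 := hle w hw _ h1 (lt_of_le_of_lt (min_le_left _ _) (by linarith))
      set ε := min (ε₀ / 2) (E / (2 * (|D| + 1)))
      have h3 : ε ≤ E / (2 * (|D| + 1)) := min_le_right _ _
      rw [le_div_iff₀ (by positivity)] at h3
      have h4 : ε * D ≤ ε * |D| := mul_le_mul_of_nonneg_left (le_abs_self D) h1.le
      nlinarith
    refine ⟨⟨hzp, hu⟩, fun w hw => ?_⟩
    have h1 := hle w hw.1 (ε₀ / 2) (by linarith) (by linarith)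
    have h2 := hw.2 z hzp
    nlinarith
  refine Set.Subset.antisymm (fun y hy => ?_) key
  obtain ⟨z, hz⟩ := hF
  have hz' := key hz
  have e1 : u ⬝ᵥ y = u ⬝ᵥ z := le_antisymm (hz'.1.2 y hy.1.1) (hy.1.2 z hz'.1.1)
  have e2 : v ⬝ᵥ y = v ⬝ᵥ z := le_antisymm (hz'.2 y hy.1) (hy.2 z hz'.1)
  have hF' := h (ε₀ / 2) (by linarith) (by linarith)
  rw [← hF'] at hz ⊢
  refine ⟨hy.1.1, fun w hw => ?_⟩
  have := hz.2 w hw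
  simp only [add_dotProduct, smul_dotProduct, e1, e2] at *
  exact this

namespace GenPerm

theorem ext_carrier {p q : GenPerm I} (h : p.carrier = q.carrier) : p = q := by
  obtain ⟨_, _, _⟩ := p
  obtain ⟨_, _, _⟩ := q
  simp only at h
  subst h
  rfl

theorem maxFace_eq (p : GenPerm I) (x y : I → ℝ) (h : ∀ i j, y i < y j ↔ x i < x j) :
    maxFace p.carrier y = maxFace p.carrier x :=
  (coarsens_iff _).1 p.coarsens x y h

/-- The face of `p` that is maximal in the direction of the indicator vector of `I`. -/
def splitFace (p : GenPerm (I ⊕ J)) : Set (I ⊕ J → ℝ) :=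
  maxFace p.carrier (Sum.elim (fun _ => 1) (fun _ => 0))

theorem splitFace_isPolytope (p : GenPerm (I ⊕ J)) : IsPolytope p.splitFace :=
  p.isPolytope.maxFace _

theorem maxFace_splitFace (p : GenPerm (I ⊕ J)) (x x' : I ⊕ J → ℝ)
    (hl : ∀ i j : I, x' (Sum.inl i) < x' (Sum.inl j) ↔ x (Sum.inl i) < x (Sum.inl j))
    (hr : ∀ i j : J, x' (Sum.inr i) < x' (Sum.inr j) ↔ x (Sum.inr i) < x (Sum.inr j)) :
    maxFace p.splitFace x' = maxFace p.splitFace x := by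
  set o : I ⊕ J → ℝ := Sum.elim (fun _ => 1) (fun _ => 0) with ho
  have hb (y : I ⊕ J → ℝ) (i) : |y i| ≤ ∑ j, |y j| :=
    Finset.single_le_sum (f := fun j => |y j|) (fun _ _ => abs_nonneg _) (Finset.mem_univ i)
  obtain ⟨M, hM, hM₁, hM₂⟩ : ∃ M : ℝ, 0 < M ∧ (∀ i, |x i| ≤ M) ∧ ∀ i, |x' i| ≤ M := by
    have h1 : 0 ≤ ∑ j, |x j| := by positivity
    have h2 : 0 ≤ ∑ j, |x' j| := by positivity
    refine ⟨∑ j, |x j| + ∑ j, |x' j| + 1, by positivity, fun i => ?_, fun i => ?_⟩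
    · linarith [hb x i]
    · linarith [hb x' i]
  have hsmall (y : I ⊕ J → ℝ) (hy : ∀ i, |y i| ≤ M) (ε : ℝ) (h₀ : 0 < ε) (h₁ : ε < 1 / (2 * M))
      (i : I ⊕ J) : |ε * y i| < 1 / 2 := by
    rw [lt_div_iff₀ (by positivity)] at h₁
    rw [abs_mul, abs_of_pos h₀]
    nlinarith [mul_le_mul_of_nonneg_left (hy i) h₀.le]
  have hsame (y y' : I ⊕ J → ℝ) (hy : ∀ i, |y i| ≤ M) (hy' : ∀ i, |y' i| ≤ M)
      (hl : ∀ i j : I, y' (Sum.inl i) < y' (Sum.inl j) ↔ y (Sum.inl i) < y (Sum.inl j))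
      (hr : ∀ i j : J, y' (Sum.inr i) < y' (Sum.inr j) ↔ y (Sum.inr i) < y (Sum.inr j))
      (ε ε' : ℝ) (h₀ : 0 < ε) (h₁ : ε < 1 / (2 * M)) (h₀' : 0 < ε') (h₁' : ε' < 1 / (2 * M)) :
      maxFace p.carrier (o + ε' • y') = maxFace p.carrier (o + ε • y) := by
    apply p.maxFace_eq
    rintro (i | i) (j | j)
    · simp [ho, h₀, h₀', hl]
    · have a1 := abs_lt.1 (hsmall y hy ε h₀ h₁ (Sum.inl i))
      have a2 := abs_lt.1 (hsmall y hy ε h₀ h₁ (Sum.inr j))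
      have a3 := abs_lt.1 (hsmall y' hy' ε' h₀' h₁' (Sum.inl i))
      have a4 := abs_lt.1 (hsmall y' hy' ε' h₀' h₁' (Sum.inr j))
      simp only [ho, Pi.add_apply, Sum.elim_inl, Sum.elim_inr, Pi.smul_apply, smul_eq_mul]
      constructor <;> intro <;> linarith
    · have a1 := abs_lt.1 (hsmall y hy ε h₀ h₁ (Sum.inr i))
      have a2 := abs_lt.1 (hsmall y hy ε h₀ h₁ (Sum.inl j))
      have a3 := abs_lt.1 (hsmall y' hy' ε' h₀' h₁' (Sum.inr i))
      have a4 := abs_lt.1 (hsmall y' hy' ε' h₀' h₁' (Sum.inl j))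
      simp only [ho, Pi.add_apply, Sum.elim_inl, Sum.elim_inr, Pi.smul_apply, smul_eq_mul]
      constructor <;> intro <;> linarith
    · simp [ho, h₀, h₀', hr]
  have hpos : 0 < 1 / (2 * M) := by positivity
  have hh0 : 0 < 1 / (2 * M) / 2 := by positivity
  have hh1 : 1 / (2 * M) / 2 < 1 / (2 * M) := by linarith
  have hne := p.isPolytope.maxFace_nonempty (o + (1 / (2 * M) / 2) • x)
  rw [splitFace, maxFace_maxFace p.carrier _ o x' _ hpos hne fun ε h₀ h₁ =>
      hsame x x' hM₁ hM₂ hl hr _ ε hh0 hh1 h₀ h₁,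
    maxFace_maxFace p.carrier _ o x _ hpos hne fun ε h₀ h₁ =>
      hsame x x hM₁ hM₁ (fun _ _ => Iff.rfl) (fun _ _ => Iff.rfl) _ ε hh0 hh1 h₀ h₁]

/-- The restriction `p|I`: the projection to `ℝ^I` of the face of `p` that is maximal in the
direction of the indicator vector of `I` (this face is the product of `p|I` and `p/I`, see
`splitFace_eq`). -/
def restrict (p : GenPerm (I ⊕ J)) : GenPerm I where
  carrier := projLeft p.splitFace
  isPolytope := p.splitFace_isPolytope.image (LinearMap.funLeft ℝ ℝ Sum.inl)
  coarsens := by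
    rw [coarsens_iff]
    intro x y h
    rw [maxFace_projLeft, maxFace_projLeft,
      p.maxFace_splitFace (Sum.elim x 0) (Sum.elim y 0) (by simpa using h) (by simp)]

/-- The contraction `p/I`: the projection to `ℝ^J` of the face of `p` that is maximal in the
direction of the indicator vector of `I`. -/
def contract (p : GenPerm (I ⊕ J)) : GenPerm J where
  carrier := projRight p.splitFace
  isPolytope := p.splitFace_isPolytope.image (LinearMap.funLeft ℝ ℝ Sum.inr)
  coarsens := by
    rw [coarsens_iff]
    intro x y h
    rw [maxFace_projRight, maxFace_projRight,
      p.maxFace_splitFace (Sum.elim 0 x) (Sum.elim 0 y) (by simp) (by simpa using h)]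

/-- The face of `p` in the direction of the indicator vector of `I` is `p|I × p/I`. -/
theorem splitFace_eq (p : GenPerm (I ⊕ J)) :
    p.splitFace = prodSet p.restrict.carrier p.contract.carrier := by
  refine Set.Subset.antisymm (fun z hz => ⟨⟨z, hz, rfl⟩, ⟨z, hz, rfl⟩⟩) fun z hz => ?_
  obtain ⟨⟨a, ha, hza⟩, ⟨b, hb, hzb⟩⟩ := hz
  refine p.splitFace_isPolytope.mem_of_forall z fun x => ?_
  obtain ⟨y, hy⟩ := p.splitFace_isPolytope.maxFace_nonempty x
  refine ⟨y, hy.1, ?_⟩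
  have hscale (s t : ℝ) (hs : 0 < s) (ht : 0 < t) (w : I ⊕ J → ℝ) (hw : w ∈ p.splitFace) :
      s * ((x ∘ Sum.inl) ⬝ᵥ (w ∘ Sum.inl)) + t * ((x ∘ Sum.inr) ⬝ᵥ (w ∘ Sum.inr)) ≤
        s * ((x ∘ Sum.inl) ⬝ᵥ (y ∘ Sum.inl)) + t * ((x ∘ Sum.inr) ⬝ᵥ (y ∘ Sum.inr)) := by
    have := hy
    rw [← p.maxFace_splitFace x (Sum.elim (s • (x ∘ Sum.inl)) (t • (x ∘ Sum.inr)))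
      (by simp [hs]) (by simp [ht])] at this
    simpa [dot_sum, smul_dotProduct] using this.2 w hw
  have hlim (A B : ℝ) (h : ∀ s : ℝ, 0 < s → A ≤ s * B) : A ≤ 0 := by
    by_contra! hA
    have h1 := h (A / (2 * (|B| + 1))) (by positivity)
    have h2 : A / (2 * (|B| + 1)) * B ≤ A / (2 * (|B| + 1)) * |B| :=
      mul_le_mul_of_nonneg_left (le_abs_self B) (by positivity)
    have h3 : A / (2 * (|B| + 1)) * (2 * (|B| + 1)) = A := div_mul_cancel₀ _ (by positivity)
    have h4 : 0 < A / (2 * (|B| + 1)) := by positivity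
    nlinarith
  have hleft : (x ∘ Sum.inl) ⬝ᵥ (a ∘ Sum.inl) ≤ (x ∘ Sum.inl) ⬝ᵥ (y ∘ Sum.inl) := by
    have := hlim _ ((x ∘ Sum.inr) ⬝ᵥ (y ∘ Sum.inr) - (x ∘ Sum.inr) ⬝ᵥ (a ∘ Sum.inr))
      fun t ht => by
        have := hscale 1 t one_pos ht a ha
        show (x ∘ Sum.inl) ⬝ᵥ (a ∘ Sum.inl) - (x ∘ Sum.inl) ⬝ᵥ (y ∘ Sum.inl) ≤ _
        linarith
    linarith
  have hright : (x ∘ Sum.inr) ⬝ᵥ (b ∘ Sum.inr) ≤ (x ∘ Sum.inr) ⬝ᵥ (y ∘ Sum.inr) := by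
    have := hlim _ ((x ∘ Sum.inl) ⬝ᵥ (y ∘ Sum.inl) - (x ∘ Sum.inl) ⬝ᵥ (b ∘ Sum.inl))
      fun t ht => by
        have := hscale t 1 ht one_pos b hb
        show (x ∘ Sum.inr) ⬝ᵥ (b ∘ Sum.inr) - (x ∘ Sum.inr) ⬝ᵥ (y ∘ Sum.inr) ≤ _
        linarith
    linarith
  simp only at hza hzb
  rw [dot_sum, dot_sum x y, ← hza, ← hzb]
  exact add_le_add hleft hright

/-- The product of generalized permutahedra. -/
def prod (p : GenPerm I) (q : GenPerm J) : GenPerm (I ⊕ J) where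
  carrier := prodSet p.carrier q.carrier
  isPolytope := p.isPolytope.prod q.isPolytope
  coarsens := by
    rw [coarsens_iff]
    intro x y h
    rw [maxFace_prod, maxFace_prod, p.maxFace_eq (x ∘ Sum.inl) (y ∘ Sum.inl) fun i j => h _ _,
      q.maxFace_eq (x ∘ Sum.inr) (y ∘ Sum.inr) fun i j => h _ _]

/-- Relabelling of coordinates along a bijection. -/
def relabel (σ : I ≃ J) (p : GenPerm I) : GenPerm J where
  carrier := relabelSet σ p.carrier
  isPolytope := p.isPolytope.relabel σ
  coarsens := by
    rw [coarsens_iff]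
    intro x y h
    rw [maxFace_relabel, maxFace_relabel, p.maxFace_eq (x ∘ σ) (y ∘ σ) fun i j => h _ _]

/-- The unique generalized permutahedron in `ℝ^∅`: a point. -/
def point : GenPerm PEmpty.{u + 1} where
  carrier := Set.univ
  isPolytope := ⟨{0}, Set.finite_singleton 0, Set.singleton_nonempty 0, by
    ext x; simp [Subsingleton.elim x 0]⟩
  coarsens := by
    rw [coarsens_iff]
    intro x y _
    rw [Subsingleton.elim x y]

theorem eq_point (p : GenPerm PEmpty.{u + 1}) : p = point := by
  apply ext_carrier
  obtain ⟨y, hy⟩ := p.isPolytope.nonempty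
  ext x
  simp [point, Subsingleton.elim x y, hy]

theorem carrier_nonempty (p : GenPerm I) : p.carrier.Nonempty := p.isPolytope.nonempty

section Laws

variable {I' J' : Type u} [Fintype I'] [Fintype J']

theorem splitFace_relabel (σ : I ≃ I') (τ : J ≃ J') (p : GenPerm (I ⊕ J)) :
    (p.relabel (Equiv.sumCongr σ τ)).splitFace = relabelSet (Equiv.sumCongr σ τ) p.splitFace := by
  simp only [splitFace, relabel, maxFace_relabel]
  congr 2
  ext (i | i) <;> simp

theorem restrict_relabel (σ : I ≃ I') (τ : J ≃ J') (p : GenPerm (I ⊕ J)) :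
    (p.relabel (Equiv.sumCongr σ τ)).restrict = p.restrict.relabel σ := by
  apply ext_carrier
  simp only [restrict, splitFace_relabel]
  ext z
  constructor
  · rintro ⟨y, hy, rfl⟩
    exact ⟨_, hy, by ext; simp⟩
  · rintro ⟨y, hy, h⟩
    refine ⟨y ∘ (Equiv.sumCongr σ τ).symm, ?_, ?_⟩
    · exact comp_symm_mem_relabelSet _ hy
    · ext i
      simpa using congrFun h (σ.symm i)

theorem contract_relabel (σ : I ≃ I') (τ : J ≃ J') (p : GenPerm (I ⊕ J)) :
    (p.relabel (Equiv.sumCongr σ τ)).contract = p.contract.relabel τ := by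
  apply ext_carrier
  simp only [contract, splitFace_relabel]
  ext z
  constructor
  · rintro ⟨y, hy, rfl⟩
    exact ⟨_, hy, by ext; simp⟩
  · rintro ⟨y, hy, h⟩
    refine ⟨y ∘ (Equiv.sumCongr σ τ).symm, ?_, ?_⟩
    · exact comp_symm_mem_relabelSet _ hy
    · ext i
      simpa using congrFun h (τ.symm i)

/-- Both iterated splittings of `p` give the same face. -/
theorem iterated_face (p : GenPerm ((I ⊕ J) ⊕ K)) :
    relabelSet (Equiv.sumAssoc I J K) (prodSet p.restrict.splitFace p.contract.carrier) =
      prodSet (p.relabel (Equiv.sumAssoc I J K)).restrict.carrier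
        (p.relabel (Equiv.sumAssoc I J K)).contract.splitFace := by
  let u : (I ⊕ J) ⊕ K → ℝ := Sum.elim (fun _ => 1) (fun _ => 0)
  let v : (I ⊕ J) ⊕ K → ℝ := Sum.elim (Sum.elim (fun _ => 1) (fun _ => 0)) (fun _ => 0)
  let v' : (I ⊕ J) ⊕ K → ℝ := Sum.elim (Sum.elim (fun _ => 0) (fun _ => 1)) (fun _ => 0)
  have h₁ : prodSet p.restrict.splitFace p.contract.carrier = maxFace (maxFace p.carrier u) v := by
    change _ = maxFace p.splitFace v
    rw [splitFace_eq p, maxFace_prod]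
    congr 1
    exact (maxFace_zero _).symm
  have h₂ : prodSet (p.relabel (Equiv.sumAssoc I J K)).restrict.carrier
      (p.relabel (Equiv.sumAssoc I J K)).contract.splitFace =
      relabelSet (Equiv.sumAssoc I J K) (maxFace (maxFace p.carrier v) v') := by
    have e₁ : (p.relabel (Equiv.sumAssoc I J K)).splitFace =
        relabelSet (Equiv.sumAssoc I J K) (maxFace p.carrier v) := by
      simp only [splitFace, relabel, maxFace_relabel]
      congr 2
      ext ((i | i) | i) <;> simp [v]
    have e₂ : v' = (Sum.elim 0 (Sum.elim (fun _ => 1) (fun _ => 0)) : I ⊕ (J ⊕ K) → ℝ) ∘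
        (Equiv.sumAssoc I J K) := by
      ext ((i | i) | i) <;> simp [v']
    rw [e₂, ← maxFace_relabel, ← e₁, splitFace_eq (p.relabel _), maxFace_prod]
    congr 1
    exact (maxFace_zero _).symm
  have hne := p.isPolytope.maxFace_nonempty (u + (1 / 2 : ℝ) • v)
  rw [h₁, h₂, maxFace_maxFace p.carrier _ u v 1 one_pos hne, 
    maxFace_maxFace p.carrier _ v v' 1 one_pos hne]
  all_goals
    intro ε h₀ h₁
    apply p.maxFace_eq
    rintro ((i | i) | i) ((j | j) | j) <;> simp [u, v, v'] <;> norm_num <;> linarith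

theorem restrict_restrict (p : GenPerm ((I ⊕ J) ⊕ K)) :
    p.restrict.restrict = (p.relabel (Equiv.sumAssoc I J K)).restrict := by
  apply ext_carrier
  have h := congrArg projLeft p.iterated_face
  rw [projLeft_prodSet (splitFace_isPolytope _).nonempty] at h
  rw [← h]
  change projLeft _ = _
  conv_lhs => rw [← projLeft_prodSet (A := p.restrict.splitFace) p.contract.carrier_nonempty]
  ext z
  constructor
  · rintro ⟨_, ⟨y, hy, rfl⟩, rfl⟩
    refine ⟨y ∘ (Equiv.sumAssoc I J K).symm, ?_, ?_⟩
    · exact comp_symm_mem_relabelSet _ hy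
    · ext; simp
  · rintro ⟨y, hy, rfl⟩
    exact ⟨_, ⟨_, hy, rfl⟩, by ext; simp⟩

theorem contract_restrict (p : GenPerm ((I ⊕ J) ⊕ K)) :
    p.restrict.contract = (p.relabel (Equiv.sumAssoc I J K)).contract.restrict := by
  apply ext_carrier
  have h := congrArg (fun A => projLeft (projRight A)) p.iterated_face
  simp only [projRight_prodSet (carrier_nonempty _)] at h
  change projRight _ = projLeft _
  rw [← h]
  conv_lhs => rw [← projLeft_prodSet (A := p.restrict.splitFace) p.contract.carrier_nonempty]
  ext z
  constructor
  · rintro ⟨_, ⟨y, hy, rfl⟩, rfl⟩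
    refine ⟨_, ⟨y ∘ (Equiv.sumAssoc I J K).symm, ?_, rfl⟩, ?_⟩
    · exact comp_symm_mem_relabelSet _ hy
    · ext; simp
  · rintro ⟨_, ⟨y, hy, rfl⟩, rfl⟩
    exact ⟨_, ⟨_, hy, rfl⟩, by ext; simp⟩

theorem contract_contract (p : GenPerm ((I ⊕ J) ⊕ K)) :
    p.contract = (p.relabel (Equiv.sumAssoc I J K)).contract.contract := by
  apply ext_carrier
  have h := congrArg (fun A => projRight (projRight A)) p.iterated_face
  simp only [projRight_prodSet (carrier_nonempty _)] at h
  change _ = projRight _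
  rw [← h]
  conv_lhs => rw [← projRight_prodSet (B := p.contract.carrier)
    p.restrict.splitFace_isPolytope.nonempty]
  ext z
  constructor
  · rintro ⟨y, hy, rfl⟩
    refine ⟨_, ⟨y ∘ (Equiv.sumAssoc I J K).symm, ?_, rfl⟩, ?_⟩
    · exact comp_symm_mem_relabelSet _ hy
    · ext; simp
  · rintro ⟨_, ⟨y, hy, rfl⟩, rfl⟩
    exact ⟨_, hy, by ext; simp⟩

theorem splitFace_prod {A B C D : Type u} [Fintype A] [Fintype B] [Fintype C] [Fintype D]
    (p : GenPerm (A ⊕ B)) (q : GenPerm (C ⊕ D)) :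
    ((p.prod q).relabel (Equiv.sumSumSumComm A B C D)).splitFace =
      relabelSet (Equiv.sumSumSumComm A B C D) (prodSet p.splitFace q.splitFace) := by
  simp only [splitFace, relabel, prod, maxFace_relabel, maxFace_prod]
  congr 3 <;> ext (i | i) <;> simp

theorem restrict_prod {A B C D : Type u} [Fintype A] [Fintype B] [Fintype C] [Fintype D]
    (p : GenPerm (A ⊕ B)) (q : GenPerm (C ⊕ D)) :
    ((p.prod q).relabel (Equiv.sumSumSumComm A B C D)).restrict = p.restrict.prod q.restrict := by
  apply ext_carrier
  change projLeft _ = prodSet (projLeft _) (projLeft _)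
  rw [splitFace_prod]
  ext z
  constructor
  · rintro ⟨y, ⟨hy, hy'⟩, rfl⟩
    exact ⟨⟨_, hy, by ext; simp⟩, ⟨_, hy', by ext; simp⟩⟩
  · rintro ⟨⟨a, ha, hza⟩, ⟨b, hb, hzb⟩⟩
    refine ⟨Sum.elim a b ∘ (Equiv.sumSumSumComm A B C D).symm, ⟨?_, ?_⟩, ?_⟩
    · convert ha using 1; ext (i | i) <;> rfl
    · convert hb using 1; ext (i | i) <;> rfl
    · ext (i | i)
      · simpa using congrFun hza i
      · simpa using congrFun hzb i

theorem contract_prod {A B C D : Type u} [Fintype A] [Fintype B] [Fintype C] [Fintype D]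
    (p : GenPerm (A ⊕ B)) (q : GenPerm (C ⊕ D)) :
    ((p.prod q).relabel (Equiv.sumSumSumComm A B C D)).contract = p.contract.prod q.contract := by
  apply ext_carrier
  change projRight _ = prodSet (projRight _) (projRight _)
  rw [splitFace_prod]
  ext z
  constructor
  · rintro ⟨y, ⟨hy, hy'⟩, rfl⟩
    exact ⟨⟨_, hy, by ext; simp⟩, ⟨_, hy', by ext; simp⟩⟩
  · rintro ⟨⟨a, ha, hza⟩, ⟨b, hb, hzb⟩⟩
    refine ⟨Sum.elim a b ∘ (Equiv.sumSumSumComm A B C D).symm, ⟨?_, ?_⟩, ?_⟩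
    · convert ha using 1; ext (i | i) <;> rfl
    · convert hb using 1; ext (i | i) <;> rfl
    · ext (i | i)
      · simpa using congrFun hza i
      · simpa using congrFun hzb i

theorem contract_empty (p : GenPerm (PEmpty.{u + 1} ⊕ I)) :
    p.contract = p.relabel (Equiv.emptySum PEmpty I) := by
  apply ext_carrier
  have h : p.splitFace = p.carrier := by
    conv_rhs => rw [← maxFace_zero p.carrier]
    rw [splitFace]; congr 1; ext (i | i) <;> simp; exact i.elim
  change projRight _ = relabelSet _ _
  rw [h]
  ext z
  constructor
  · rintro ⟨y, hy, rfl⟩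
    have e : (y ∘ Sum.inr) ∘ Equiv.emptySum PEmpty I = y := by
      ext (i | i)
      · exact i.elim
      · simp
    exact (congrArg (· ∈ p.carrier) e).mpr hy
  · intro hz
    exact ⟨_, hz, by ext; simp⟩

theorem restrict_empty (p : GenPerm (I ⊕ PEmpty.{u + 1})) :
    p.restrict = p.relabel (Equiv.sumEmpty I PEmpty) := by
  apply ext_carrier
  have h : p.splitFace = p.carrier := by
    conv_rhs => rw [← maxFace_zero p.carrier]
    apply p.maxFace_eq
    rintro (i | i) (j | j)
    · simp
    · exact j.elim
    · exact i.elim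
    · exact i.elim
  change projLeft _ = relabelSet _ _
  rw [h]
  ext z
  constructor
  · rintro ⟨y, hy, rfl⟩
    have e : (y ∘ Sum.inl) ∘ Equiv.sumEmpty I PEmpty = y := by
      ext (i | i)
      · simp
      · exact i.elim
    exact (congrArg (· ∈ p.carrier) e).mpr hy
  · intro hz
    exact ⟨_, hz, by ext; simp⟩

theorem prod_relabel (σ : I ≃ I') (τ : J ≃ J') (p : GenPerm I) (q : GenPerm J) :
    (p.prod q).relabel (Equiv.sumCongr σ τ) = (p.relabel σ).prod (q.relabel τ) := rfl

theorem prod_assoc (p : GenPerm I) (q : GenPerm J) (r : GenPerm K) :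
    ((p.prod q).prod r).relabel (Equiv.sumAssoc I J K) = p.prod (q.prod r) := by
  apply ext_carrier
  ext z
  exact and_assoc

theorem point_prod (p : GenPerm I) :
    (point.prod p).relabel (Equiv.emptySum PEmpty I) = p := by
  apply ext_carrier
  ext z
  exact iff_of_eq (true_and _)

theorem prod_point (p : GenPerm I) :
    (p.prod point).relabel (Equiv.sumEmpty I PEmpty) = p := by
  apply ext_carrier
  ext z
  exact iff_of_eq (and_true _)

end Laws

end GenPerm

variable (k : Type v) [Field k]

/-- The vector space spanned by the generalized permutahedra in `ℝ^I`. -/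
abbrev GenPermSpace (I : Type u) [Fintype I] : Type (max u v) := GenPerm I →₀ k

namespace GenPermSpace

/-- Relabelling, extended linearly. -/
noncomputable def map (σ : I ≃ J) : GenPermSpace k I →ₗ[k] GenPermSpace k J :=
  Finsupp.lmapDomain k k (GenPerm.relabel σ)

/-- The product `p ⊗ q ↦ p × q`. -/
noncomputable def mul (I J : Type u) [Fintype I] [Fintype J] :
    GenPermSpace k I ⊗[k] GenPermSpace k J →ₗ[k] GenPermSpace k (I ⊕ J) :=
  TensorProduct.lift (Finsupp.lift _ k _ fun p : GenPerm I => Finsupp.lift _ k _ fun q : GenPerm J =>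
    Finsupp.single (p.prod q) 1)

/-- The coproduct `p ↦ p|I ⊗ p/I`. -/
noncomputable def comul (I J : Type u) [Fintype I] [Fintype J] :
    GenPermSpace k (I ⊕ J) →ₗ[k] GenPermSpace k I ⊗[k] GenPermSpace k J :=
  Finsupp.lift _ k _ fun p : GenPerm (I ⊕ J) =>
    Finsupp.single p.restrict 1 ⊗ₜ[k] Finsupp.single p.contract 1

/-- The counit, with value `1` on the point. -/
noncomputable def counit : GenPermSpace k PEmpty.{u + 1} →ₗ[k] k :=
  Finsupp.lift _ k _ fun _ => 1

theorem map_single (σ : I ≃ J) (p : GenPerm I) (r : k) :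
    map k σ (Finsupp.single p r) = Finsupp.single (p.relabel σ) r := by
  simp [map]

theorem mul_single (p : GenPerm I) (q : GenPerm J) (r s : k) :
    mul k I J (Finsupp.single p r ⊗ₜ Finsupp.single q s) =
      Finsupp.single (p.prod q) (r * s) := by
  simp [mul]

theorem comul_single (p : GenPerm (I ⊕ J)) (r : k) :
    comul k I J (Finsupp.single p r) =
      Finsupp.single p.restrict r ⊗ₜ[k] Finsupp.single p.contract 1 := by
  simp [comul, TensorProduct.smul_tmul']

theorem counit_single (p : GenPerm PEmpty.{u + 1}) (r : k) :
    counit k (Finsupp.single p r) = r := by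
  simp [counit]

end GenPermSpace

open GenPerm GenPermSpace in
/-- The Hopf monoid `GP` of generalized permutahedra. -/
@[reducible] noncomputable def GP : ConnectedHopfMonoid.{u, v, max u v} k where
  obj I _ := GenPermSpace k I
  map σ := GenPermSpace.map k σ
  mul I J _ _ := GenPermSpace.mul k I J
  one := Finsupp.single GenPerm.point 1
  comul I J _ _ := GenPermSpace.comul k I J
  counit := GenPermSpace.counit k
  map_refl I _ x := by
    induction x using Finsupp.induction_linear with
    | zero => simp
    | add x y hx hy => simp only [map_add, hx, hy]
    | single p r => rw [GenPermSpace.map_single]; rfl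
  map_trans σ τ x := by
    induction x using Finsupp.induction_linear with
    | zero => simp
    | add x y hx hy => simp only [map_add, hx, hy]
    | single p r => simp only [GenPermSpace.map_single]; rfl
  mul_natural σ τ x y := by
    induction x using Finsupp.induction_linear with
    | zero => simp
    | add x y hx hy => simp only [TensorProduct.add_tmul, map_add, hx, hy]
    | single p r =>
      induction y using Finsupp.induction_linear with
      | zero => simp
      | add x y hx hy => simp only [TensorProduct.tmul_add, map_add, hx, hy]
      | single q s => simp only [GenPermSpace.map_single, mul_single, prod_relabel]
  comul_natural σ τ x := by
    induction x using Finsupp.induction_linear with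
    | zero => simp
    | add x y hx hy => simp only [map_add, hx, hy]
    | single p r =>
      simp only [GenPermSpace.map_single, comul_single, TensorProduct.map_tmul, restrict_relabel,
        contract_relabel]
  mul_assoc I J K _ _ _ x y z := by
    induction x using Finsupp.induction_linear with
    | zero => simp
    | add x y hx hy => simp only [TensorProduct.add_tmul, map_add, hx, hy]
    | single p r =>
    induction y using Finsupp.induction_linear with
    | zero => simp
    | add x y hx hy => simp only [TensorProduct.add_tmul, TensorProduct.tmul_add, map_add, hx, hy]
    | single q s =>
    induction z using Finsupp.induction_linear with
    | zero => simp
    | add x y hx hy => simp only [TensorProduct.tmul_add, map_add, hx, hy]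
    | single t c => simp only [GenPermSpace.map_single, mul_single, prod_assoc, _root_.mul_assoc]
  one_mul I _ x := by
    induction x using Finsupp.induction_linear with
    | zero => simp
    | add x y hx hy => simp only [TensorProduct.tmul_add, map_add, hx, hy]
    | single p r => simp only [GenPermSpace.map_single, mul_single, point_prod, _root_.one_mul]
  mul_one I _ x := by
    induction x using Finsupp.induction_linear with
    | zero => simp
    | add x y hx hy => simp only [TensorProduct.add_tmul, map_add, hx, hy]
    | single p r => simp only [GenPermSpace.map_single, mul_single, prod_point, _root_.mul_one]
  comul_coassoc I J K _ _ _ x := by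
    induction x using Finsupp.induction_linear with
    | zero => simp
    | add x y hx hy => simp only [map_add, hx, hy]
    | single p r =>
      simp only [GenPermSpace.map_single, comul_single, TensorProduct.map_tmul,
        TensorProduct.assoc_tmul, LinearMap.id_apply, restrict_restrict, contract_restrict,
        ← contract_contract]
  counit_comul I _ x := by
    induction x using Finsupp.induction_linear with
    | zero => simp
    | add x y hx hy => simp only [map_add, hx, hy]
    | single p r =>
      simp only [GenPermSpace.map_single, comul_single, TensorProduct.map_tmul, counit_single,
        TensorProduct.lid_tmul, LinearMap.id_apply, contract_empty, Finsupp.smul_single,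
        smul_eq_mul, _root_.mul_one]
  comul_counit I _ x := by
    induction x using Finsupp.induction_linear with
    | zero => simp
    | add x y hx hy => simp only [map_add, hx, hy]
    | single p r =>
      simp only [GenPermSpace.map_single, comul_single, TensorProduct.map_tmul, counit_single,
        TensorProduct.rid_tmul, LinearMap.id_apply, restrict_empty, one_smul]
  comul_mul A B C D _ _ _ _ x y := by
    induction x using Finsupp.induction_linear with
    | zero => simp
    | add x y hx hy => simp only [TensorProduct.add_tmul, map_add, hx, hy]
    | single p r =>
      induction y using Finsupp.induction_linear with
      | zero => simp
      | add x y hx hy => simp only [TensorProduct.tmul_add, map_add, hx, hy]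
      | single q s =>
        simp only [GenPermSpace.map_single, comul_single, mul_single, TensorProduct.map_tmul,
          TensorProduct.tensorTensorTensorComm_tmul, restrict_prod, contract_prod, _root_.mul_one]
  comul_one := by
    rw [GenPermSpace.map_single, comul_single, eq_point (restrict _), eq_point (contract _)]
  counit_mul x y := by
    induction x using Finsupp.induction_linear with
    | zero => simp
    | add x y hx hy => simp only [TensorProduct.add_tmul, map_add, hx, hy, add_mul]
    | single p r =>
      induction y using Finsupp.induction_linear with
      | zero => simp
      | add x y hx hy => simp only [TensorProduct.tmul_add, map_add, hx, hy, mul_add]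
      | single q s => simp only [GenPermSpace.map_single, mul_single, counit_single]
  counit_one := counit_single k _ _
  connected x := by
    induction x using Finsupp.induction_linear with
    | zero => simp
    | add x y hx hy => rw [map_add, add_smul, hx, hy]
    | single p r => simp [counit_single, eq_point p]

/-- The Hopf monoid `OGP` of ordered generalized permutahedra. -/
@[reducible] noncomputable def OGP : ConnectedHopfMonoid.{u, v, max u v} k := hadamard (LStar k) (GP k)

/-- The symmetrization map `GP[I] → OGP[I]`, `p ↦ ∑ w, w ⊗ p`. -/
noncomputable def symmetrization (I : Type u) [Fintype I] : (GP k).obj I →ₗ[k] (OGP k).obj I :=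
  Finsupp.lift (LinOrdSpace k I ⊗[k] GenPermSpace k I) k (GenPerm I) fun p =>
    ∑ w : LinearOrdering I, Finsupp.single w 1 ⊗ₜ[k] Finsupp.single p 1

end GeneralizedPermutahedra

/-!
The symmetrization map is `x ↦ s_I ⊗ x`, where `s_I` is the sum of all linear orders on `I`; a
coefficient functional takes the value `1` on `s_I`, so this map is injective. For connected Hopf
monoids `H` and `K`, the maps `x ↦ s_I ⊗ x` form a morphism `K → H × K` as soon as the elements
`s_I ∈ H[I]` are natural in `I` and satisfy `s_I s_J = s_{I ⊔ J}`, `Δ_{I,J}(s_{I ⊔ J}) = s_I ⊗ s_J`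
and `s_∅ = 1`. In `L*`, the first identity holds because an order on `I ⊔ J` is a shuffle of exactly
one pair of orders, and the second because every pair of orders arises from exactly one order with
initial segment `I`, their concatenation.
-/

section TensorProductMk

variable {R M N M' N' : Type*} [CommSemiring R] [AddCommMonoid M] [AddCommMonoid N]
  [AddCommMonoid M'] [AddCommMonoid N'] [Module R M] [Module R N] [Module R M'] [Module R N']

theorem tensorProduct_mk_injective_of_apply_eq_one (f : M →ₗ[R] R) {m : M} (hm : f m = 1) :
    Function.Injective (TensorProduct.mk R M N m) :=
  Function.LeftInverse.injective (g := TensorProduct.lid R N ∘ f.rTensor N) fun n => by simp [hm]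

theorem tensorTensorTensorComm_tmul_eq_map_mk (m : M) (m' : M') (t : N ⊗[R] N') :
    TensorProduct.tensorTensorTensorComm R M M' N N' ((m ⊗ₜ m') ⊗ₜ t) =
      TensorProduct.map (TensorProduct.mk R M N m) (TensorProduct.mk R M' N' m') t := by
  induction t with
  | zero => simp only [TensorProduct.tmul_zero, map_zero]
  | add x y hx hy => simp only [TensorProduct.tmul_add, map_add, hx, hy]
  | tmul n n' => rfl

end TensorProductMk

/-- A series `s_I ∈ H[I]` that is both exponential (compatible with products) and group-like
(compatible with coproducts). Such series are the morphisms to `H` from the exponential Hopf monoid,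
which has `k` as its value on every finite set: `s_I` is the image of `1 : k`. -/
structure IsHopfSeries {k : Type v} [Field k] (H : ConnectedHopfMonoid.{u, v, w} k)
    (s : ∀ (I : Type u) [Fintype I], H.obj I) : Prop where
  map_eq : ∀ {I J : Type u} [Fintype I] [Fintype J] (σ : I ≃ J), H.map σ (s I) = s J
  mul_eq : ∀ (I J : Type u) [Fintype I] [Fintype J], H.mul I J (s I ⊗ₜ s J) = s (I ⊕ J)
  empty_eq : s PEmpty = H.one
  comul_eq : ∀ (I J : Type u) [Fintype I] [Fintype J], H.comul I J (s (I ⊕ J)) = s I ⊗ₜ s J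

theorem IsHopfSeries.isHopfMorphism_mk {k : Type v} [Field k]
    {H : ConnectedHopfMonoid.{u, v, w} k} {s : ∀ (I : Type u) [Fintype I], H.obj I}
    (hs : IsHopfSeries H s) (K : ConnectedHopfMonoid.{u, v, w'} k) :
    IsHopfMorphism K (hadamard H K) fun I _ => TensorProduct.mk k (H.obj I) (K.obj I) (s I) where
  natural σ x := by simp [hs.map_eq]
  map_mul I J _ _ x y := by simp [hs.mul_eq]
  map_one := by simp [hs.empty_eq]
  map_comul I J _ _ x := by simp [hs.comul_eq, tensorTensorTensorComm_tmul_eq_map_mk]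
  map_counit x := by simp [hs.empty_eq, H.counit_one]

instance {I : Type u} : Nonempty (LinearOrdering I) :=
  let _ : LinearOrder I := IsWellOrder.linearOrder WellOrderingRel
  ⟨⟨(· ≤ ·), inferInstance⟩⟩

namespace LinOrdSpace

variable (k : Type v) [Field k]

/-- The sum of all linear orders on `I`. -/
noncomputable def allOrders (I : Type u) [Fintype I] : LinOrdSpace k I :=
  ∑ w : LinearOrdering I, Finsupp.single w 1

variable {I J : Type u} [Fintype I] [Fintype J]

theorem allOrders_apply (w : LinearOrdering I) : allOrders k I w = 1 := by
  classical
  simp [allOrders, Finsupp.finsetSum_apply, Finsupp.single_apply]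

theorem map_allOrders (σ : I ≃ J) : map k σ (allOrders k I) = allOrders k J := by
  ext w
  simp only [map_apply, allOrders_apply]

theorem mul_allOrders : mul k I J (allOrders k I ⊗ₜ allOrders k J) = allOrders k (I ⊕ J) := by
  ext v
  simp only [mul_apply, allOrders_apply, mul_one]

theorem comul_allOrders :
    comul k I J (allOrders k (I ⊕ J)) = allOrders k I ⊗ₜ allOrders k J := by
  apply (finsuppTensorFinsupp' k _ _).injective
  ext ⟨w, u⟩
  simp only [comul_coeff, finsuppTensorFinsupp'_apply_apply, allOrders_apply, mul_one]

theorem allOrders_empty : allOrders k PEmpty.{u + 1} = Finsupp.single LinearOrdering.empty 1 := by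
  ext w
  rw [allOrders_apply, LinearOrdering.eq_empty w, Finsupp.single_eq_same]

theorem isHopfSeries_allOrders :
    IsHopfSeries (LStar.{u, v} k) fun I _ => allOrders k I where
  map_eq := map_allOrders k
  mul_eq _ _ _ _ := mul_allOrders k
  empty_eq := allOrders_empty k
  comul_eq _ _ _ _ := comul_allOrders k

theorem mk_allOrders_injective (I : Type u) [Fintype I] (V : Type*) [AddCommMonoid V] [Module k V] :
    Function.Injective (TensorProduct.mk k (LinOrdSpace k I) V (allOrders k I)) :=
  let ⟨w⟩ := (inferInstance : Nonempty (LinearOrdering I))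
  tensorProduct_mk_injective_of_apply_eq_one (Finsupp.lapply w) (allOrders_apply k w)

end LinOrdSpace

theorem symmetrization_eq_mk_allOrders (k : Type v) [Field k] (I : Type u) [Fintype I] :
    symmetrization k I =
      TensorProduct.mk k (LinOrdSpace k I) (GenPermSpace k I) (LinOrdSpace.allOrders k I) :=
  Finsupp.lhom_ext fun p r => by
    simp [symmetrization, LinOrdSpace.allOrders, ← TensorProduct.sum_tmul,
      ← TensorProduct.tmul_smul]

theorem theorem3p2_general (k : Type v) [Field k] (K : ConnectedHopfMonoid.{u, v, w} k) :
    IsHopfMorphism K (hadamard (LStar.{u, v} k) K)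
        (fun I _ => TensorProduct.mk k _ (K.obj I) (LinOrdSpace.allOrders k I)) ∧
      ∀ (I : Type u) [Fintype I],
        Function.Injective (TensorProduct.mk k _ (K.obj I) (LinOrdSpace.allOrders k I)) :=
  ⟨(LinOrdSpace.isHopfSeries_allOrders k).isHopfMorphism_mk K,
    fun I _ => LinOrdSpace.mk_allOrders_injective k I (K.obj I)⟩

theorem theorem3p2 (k : Type v) [Field k] :
    IsHopfMorphism (GP.{u, v} k) (OGP.{u, v} k) (fun I _ => symmetrization k I) ∧
      ∀ (I : Type u) [Fintype I], Function.Injective (symmetrization k I) := by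
  simpa only [symmetrization_eq_mk_allOrders] using theorem3p2_general k (GP k)
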